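/- **Corollary 3.11.** Let $X$ be a smooth manifold of dimension $n$ with cotangent bundle $T^*$, let $E$ be a smooth real vector bundle of finite rank over $X$, and let $R_q\subset J_q(E)$ be a linear system of partial differential equations of order $q$, that is, the kernel of a smooth epimorphism of vector bundles $\Phi:J_q(E)\to F_0=J_q(E)/R_q$, with operator $\mathcal D=\Phi\circ j_q$. For $r\ge 0$ let $\rho_r(\Phi):J_{q+r}(E)\to J_r(F_0)$, $j_{q+r}(f)\mapsto j_r(\mathcal D f)$, be its prolongations, and put $R_{q+r}=\ker\rho_r(\Phi)$ and $B_r=\operatorname{im}\rho_r(\Phi)$. Let $g_q=R_q\cap (S_qT^*\otimes E)$ be the symbol, $g_{q+r}\subset S_{q+r}T^*\otimes E$ its $r$-th prolongation, $\sigma_r(\Phi):S_{q+r}T^*\otimes E\to S_rT^*\otimes F_0$ the symbol map of $\rho_r(\Phi)$, and $h_r=\operatorname{im}\sigma_r(\Phi)$. (In coordinates, if $\mathcal D f=\sum_{|\mu|\le q}a_\mu\,\partial_\mu f$, then $(\sigma_r(\Phi)v)_\nu=\sum_{|\mu|=q}a_\mu v_{\mu+\nu}$ for $|\nu|=r$.)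 A symbol $g_k\subset S_kT^*\otimes W$, with prolongations $g_{k+r}$, is called $p$-acyclic if at every point of $X$ the cohomology of the Spencer $\delta$-sequences $$\wedge^{i-1}T^*\otimes g_{k+r+1}\xrightarrow{\ \delta\ }\wedge^{i}T^*\otimes g_{k+r}\xrightarrow{\ \delta\ }\wedge^{i+1}T^*\otimes S_{k+r-1}T^*\otimes W$$ at $\wedge^iT^*\otimes g_{k+r}$ vanishes for all $1\le i\le p$ and $r\ge 0$ (with $S_{-1}T^*=0$). Suppose that $R_q$ is formally integrable: for all $r\ge0$, $R_{q+r}$ is a vector bundle and $R_{q+r+1}\to R_{q+r}$ is onto. Let $s\ge 0$ be such that $g_{q+s}$ is $2$-acyclic (for instance, when $R_q$ is not involutive, the exact number of prolongations after which $g_q$ becomes $2$-acyclic), let $\mathcal D_1=\Psi\circ j_{s+1}$ with $\Psi:J_{s+1}(F_0)\to F_1=J_{s+1}(F_0)/B_{s+1}$ be the operator of compatibility conditions of $\mathcal D$, and let $s'\ge 0$. If $g_{q+s+s'}$ is $3$-acyclic, then the symbol $h_{s+s'+1}$, which is the $s'$-th prolongation of the symbol $B_{s+1}\cap (S_{s+1}T^*\otimes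 F_0)$ of $\mathcal D_1$, is $2$-acyclic. -/

import Mathlib

open Set Filter Topology Bundle Manifold
open scoped ContDiff

/-! ### Symmetric tensors, the Spencer map and acyclicity -/

section SpencerAlgebra

/-- Multi-indices `μ = (μ₁, …, μₙ)` of length `|μ| = k`. -/
abbrev MIdx (n k : ℕ) : Type := {μ : Fin n → ℕ // ∑ i, μ i = k}

/-- Multi-indices of length at most `k`. -/
abbrev MIdxLE (n k : ℕ) : Type := {μ : Fin n → ℕ // ∑ i, μ i ≤ k}

instance MIdxLE.finite (n k : ℕ) : Finite (MIdxLE n k) := by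
  refine Set.Finite.subset (Set.finite_Iic (fun _ : Fin n => k)) ?_
  intro μ hμ i
  exact (Finset.single_le_sum (f := μ) (fun _ _ => Nat.zero_le _) (Finset.mem_univ i)).trans hμ

noncomputable instance MIdxLE.fintype (n k : ℕ) : Fintype (MIdxLE n k) := Fintype.ofFinite _

/-- `μ + 1ᵢ`. -/
def MIdx.succ {n k : ℕ} (μ : MIdx n k) (i : Fin n) : MIdx n (k + 1) :=
  ⟨μ.1 + Pi.single i 1, by simp [Finset.sum_add_distrib, μ.2]⟩

/-- `μ + ν`. -/
def MIdx.add {n k r : ℕ} (μ : MIdx n k) (ν : MIdx n r) : MIdx n (k + r) :=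
  ⟨μ.1 + ν.1, by simp [Finset.sum_add_distrib, μ.2, ν.2]⟩

/-- The fibre of `S_k T* ⊗ W` in linear coordinates: the families `v = (v_μ)`, `|μ| = k`, with values
in `W`. Here `v_μ` is the value of the symmetric tensor on `μ₁` copies of the first basis vector,
`μ₂` copies of the second one, and so on (the convention in which `v_μ` stands for `∂_μ f`). -/
abbrev SymT (n k : ℕ) (W : Type*) : Type _ := MIdx n k → W

/-- The model tangent space. -/
abbrev TSp (n : ℕ) : Type := EuclideanSpace ℝ (Fin n)

variable {n : ℕ} {W : Type*} [AddCommGroup W] [Module ℝ W]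

/-- Contraction of a symmetric tensor with a vector, `(ξ ⌟ v)_μ = ∑ᵢ ξᵢ v_{μ + 1ᵢ}`; it is zero on
`S_0 T* ⊗ W = W` (where the target `S_{-1} T* ⊗ W` is zero). -/
def contr : (k : ℕ) → TSp n →ₗ[ℝ] SymT n k W →ₗ[ℝ] SymT n (k - 1) W
  | 0 => 0
  | k + 1 => LinearMap.mk₂ ℝ (fun (ξ : TSp n) (v : SymT n (k + 1) W) (μ : MIdx n k) =>
      ∑ i, ξ i • v (μ.succ i))
      (fun ξ ξ' v => by funext μ; simp [add_smul, Finset.sum_add_distrib])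
      (fun c ξ v => by funext μ; simp [mul_smul, Finset.smul_sum])
      (fun ξ v v' => by funext μ; simp [Finset.sum_add_distrib])
      (fun c ξ v => by funext μ; simp [Finset.smul_sum, smul_comm c])

/-- `∧^i T* ⊗ S_k T* ⊗ W`: the alternating `i`-forms with values in `S_k T* ⊗ W`. -/
abbrev FormT (n i k : ℕ) (W : Type*) [AddCommGroup W] [Module ℝ W] : Type _ :=
  TSp n [⋀^Fin i]→ₗ[ℝ] SymT n k W

/-- The Spencer map `δ : ∧^i T* ⊗ S_k T* ⊗ W → ∧^{i+1} T* ⊗ S_{k-1} T* ⊗ W`,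
`(δ α)(ξ₀, …, ξᵢ) = ∑ⱼ (-1)^j ξⱼ ⌟ α(ξ₀, …, omit ξⱼ, …, ξᵢ)`,
that is `(δ α)_μ = ∑ⱼ dx^j ∧ α_{μ + 1ⱼ}`. -/
def spencerDelta (i k : ℕ) : FormT n i k W →ₗ[ℝ] FormT n (i + 1) (k - 1) W where
  toFun α := AlternatingMap.alternatizeUncurryFin
    { toFun := fun ξ => (contr k ξ).compAlternatingMap α
      map_add' := fun ξ ξ' => by ext v; simp
      map_smul' := fun c ξ => by ext v; simp }
  map_add' α α' := by
    ext v : 1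
    simp [AlternatingMap.alternatizeUncurryFin_apply, Finset.sum_add_distrib]
  map_smul' c α := by
    ext v : 1
    simp only [AlternatingMap.alternatizeUncurryFin_apply, AlternatingMap.smul_apply,
      RingHom.id_apply, LinearMap.coe_mk, AddHom.coe_mk, LinearMap.compAlternatingMap_apply,
      map_smul, Finset.smul_sum]
    exact Finset.sum_congr rfl fun j _ => smul_comm _ _ _

/-- The first prolongation `{v ∈ S_{k+1} T* ⊗ W | ξ ⌟ v ∈ g for all ξ}` of `g ⊆ S_k T* ⊗ W`: if `g` is
given by the equations `a^{τμ} v_μ = 0`, it is given by the equations `a^{τμ} v_{μ + 1ᵢ} = 0`. -/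
def prolongOne {k : ℕ} (g : Submodule ℝ (SymT n k W)) : Submodule ℝ (SymT n (k + 1) W) :=
  ⨅ ξ : TSp n, g.comap (contr (k + 1) ξ)

/-- The `r`-th prolongation `g_{k+r} ⊆ S_{k+r} T* ⊗ W` of `g = g_k ⊆ S_k T* ⊗ W`. -/
def prolong {k : ℕ} (g : Submodule ℝ (SymT n k W)) : (r : ℕ) → Submodule ℝ (SymT n (k + r) W)
  | 0 => g
  | r + 1 => prolongOne (prolong g r)

/-- `∧^i T* ⊗ g`, for a subspace `g ⊆ S_k T* ⊗ W`. -/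
def formsIn (i : ℕ) {k : ℕ} (g : Submodule ℝ (SymT n k W)) : Submodule ℝ (FormT n i k W) where
  carrier := {α | ∀ ξ, α ξ ∈ g}
  add_mem' h h' ξ := g.add_mem (h ξ) (h' ξ)
  zero_mem' _ := g.zero_mem
  smul_mem' c _ h ξ := g.smul_mem c (h ξ)

/-- The cocycle space `Z^i_{k+r}(g)` at `∧^i T* ⊗ g_{k+r}`. -/
def cocycles {k : ℕ} (g : Submodule ℝ (SymT n k W)) (i r : ℕ) :
    Submodule ℝ (FormT n i (k + r) W) :=
  formsIn i (prolong g r) ⊓ LinearMap.ker (spencerDelta i (k + r))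

/-- The coboundary space `B^i_{k+r}(g)` at `∧^i T* ⊗ g_{k+r}`, for `i ≥ 1` (here `i = j + 1`): the image
of `∧^j T* ⊗ g_{k+r+1}`. -/
def coboundaries {k : ℕ} (g : Submodule ℝ (SymT n k W)) (j r : ℕ) :
    Submodule ℝ (FormT n (j + 1) (k + r) W) :=
  (formsIn j (prolong g (r + 1))).map (spencerDelta j (k + (r + 1)))

/-- `g` is `p`-acyclic: the Spencer cohomology spaces `H^i_{k+r}(g) = Z^i_{k+r}(g) / B^i_{k+r}(g)` vanish
for `1 ≤ i ≤ p` and all `r ≥ 0`, that is, every cocycle is a coboundary. -/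
def IsAcyclic (p : ℕ) {k : ℕ} (g : Submodule ℝ (SymT n k W)) : Prop :=
  ∀ j < p, ∀ r : ℕ, cocycles g (j + 1) r ≤ coboundaries g j r

/-- The fibre of `J_k(W)` in local coordinates: the families `(y_μ)`, `0 ≤ |μ| ≤ k`. -/
abbrev Jet (n k : ℕ) (W : Type*) : Type _ := MIdxLE n k → W

/-- The inclusion `S_k T* ⊗ W → J_k(W)`. -/
def jetTop (n k : ℕ) (W : Type*) [AddCommGroup W] [Module ℝ W] : SymT n k W →ₗ[ℝ] Jet n k W where
  toFun v μ := if h : ∑ i, μ.1 i = k then v ⟨μ.1, h⟩ else 0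
  map_add' v v' := by funext μ; by_cases h : ∑ i, μ.1 i = k <;> simp [h]
  map_smul' c v := by funext μ; by_cases h : ∑ i, μ.1 i = k <;> simp [h]

/-- The projection `π : J_{k+1}(W) → J_k(W)`. -/
def jetProj (n k : ℕ) (W : Type*) [AddCommGroup W] [Module ℝ W] :
    Jet n (k + 1) W →ₗ[ℝ] Jet n k W where
  toFun y μ := y ⟨μ.1, μ.2.trans (Nat.le_succ k)⟩
  map_add' _ _ := rfl
  map_smul' _ _ := rfl

/-- The symbol `R ∩ (S_k T* ⊗ W)` of a subspace `R ⊆ J_k(W)`. -/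
def symbolOf {k : ℕ} (R : Submodule ℝ (Jet n k W)) : Submodule ℝ (SymT n k W) :=
  R.comap (jetTop n k W)

end SpencerAlgebra

set_option linter.unusedSectionVars false

/-! ### Jets of local sections of a vector bundle -/

section PartialDerivatives

variable {n : ℕ} {W : Type*} [NormedAddCommGroup W] [NormedSpace ℝ W]

/-- The partial derivative `∂ᵢ u`. -/
noncomputable def pderiv (i : Fin n) (u : TSp n → W) : TSp n → W :=
  fun z => fderiv ℝ u z (EuclideanSpace.single i 1)

/-- Iterated partial derivatives along a list of coordinate directions. -/
noncomputable def pderivList (l : List (Fin n)) (u : TSp n → W) : TSp n → W :=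
  l.foldr pderiv u

/-- `∂_μ u = ∂₁^{μ₁} ⋯ ∂ₙ^{μₙ} u`. -/
noncomputable def mderiv (μ : Fin n → ℕ) (u : TSp n → W) : TSp n → W :=
  pderivList ((List.finRange n).flatMap fun i => List.replicate (μ i) i) u

/-- `u` is smooth in a neighbourhood of `z`. -/
def SmoothNear (u : TSp n → W) (z : TSp n) : Prop := ∀ᶠ y in 𝓝 z, ContDiffAt ℝ ∞ u y

theorem SmoothNear.eventually {u : TSp n → W} {z : TSp n} (h : SmoothNear u z) :
    ∀ᶠ y in 𝓝 z, SmoothNear u y := eventually_eventually_nhds.2 h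

theorem SmoothNear.pderiv {u : TSp n → W} {z : TSp n} (h : SmoothNear u z) (i : Fin n) :
    SmoothNear (pderiv i u) z := by
  filter_upwards [h] with y hy
  exact (hy.fderiv_right (m := ∞) (by simp)).clm_apply contDiffAt_const

theorem SmoothNear.pderivList {u : TSp n → W} {z : TSp n} (h : SmoothNear u z)
    (l : List (Fin n)) : SmoothNear (pderivList l u) z := by
  induction l with
  | nil => exact h
  | cons i l ih => exact ih.pderiv i

theorem SmoothNear.mderiv {u : TSp n → W} {z : TSp n} (h : SmoothNear u z)
    (μ : Fin n → ℕ) : SmoothNear (mderiv μ u) z := h.pderivList _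

theorem SmoothNear.differentiableAt {u : TSp n → W} {z : TSp n} (h : SmoothNear u z) :
    DifferentiableAt ℝ u z := h.self_of_nhds.differentiableAt (by simp)

theorem pderivList_congr {u w : TSp n → W} {z : TSp n} (h : u =ᶠ[𝓝 z] w) (l : List (Fin n)) :
    pderivList l u =ᶠ[𝓝 z] pderivList l w := by
  induction l with
  | nil => exact h
  | cons i l ih =>
    filter_upwards [ih.fderiv (𝕜 := ℝ)] with y hy
    exact congrArg (fun L : TSp n →L[ℝ] W => L (EuclideanSpace.single i 1)) hy

theorem pderivList_add {u w : TSp n → W} {z : TSp n} (hu : SmoothNear u z) (hw : SmoothNear w z)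
    (l : List (Fin n)) :
    pderivList l (u + w) =ᶠ[𝓝 z] pderivList l u + pderivList l w := by
  induction l with
  | nil => rfl
  | cons i l ih =>
    filter_upwards [ih.fderiv (𝕜 := ℝ), (hu.pderivList l).eventually,
      (hw.pderivList l).eventually] with y hy h1 h2
    change fderiv ℝ (pderivList l (u + w)) y _ =
      fderiv ℝ (pderivList l u) y _ + fderiv ℝ (pderivList l w) y _
    rw [hy, fderiv_add h1.differentiableAt h2.differentiableAt]
    rfl

theorem pderivList_smul {u : TSp n → W} {z : TSp n} (hu : SmoothNear u z) (c : ℝ)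
    (l : List (Fin n)) : pderivList l (c • u) =ᶠ[𝓝 z] c • pderivList l u := by
  induction l with
  | nil => rfl
  | cons i l ih =>
    filter_upwards [ih.fderiv (𝕜 := ℝ), (hu.pderivList l).eventually] with y hy h1
    change fderiv ℝ (pderivList l (c • u)) y _ = c • fderiv ℝ (pderivList l u) y _
    rw [hy, fderiv_const_smul h1.differentiableAt]
    rfl

end PartialDerivatives

section Bundles

variable {n : ℕ} {X : Type*} [TopologicalSpace X] [ChartedSpace (TSp n) X]

section OneBundle

variable {F : Type*} [NormedAddCommGroup F] [NormedSpace ℝ F]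
  (E : X → Type*) [TopologicalSpace (TotalSpace F E)]
  [∀ x, AddCommGroup (E x)] [∀ x, Module ℝ (E x)] [∀ x, TopologicalSpace (E x)]
  [FiberBundle F E]

variable (F) in
/-- The expression of a section `f` of `E` in the preferred chart of the base and the preferred
trivialization of `E` around the point `x`. -/
noncomputable def locRep {E : X → Type*} [TopologicalSpace (TotalSpace F E)]
    [∀ x, TopologicalSpace (E x)] [FiberBundle F E] (x : X) (f : ∀ y, E y) : TSp n → F :=
  fun z => (trivializationAt F E x ⟨(chartAt (TSp n) x).symm z, f ((chartAt (TSp n) x).symm z)⟩).2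

/-- The `k`-jet at `x` of a section, in the local coordinates around `x`: its derivatives of order at
most `k` at `x`. -/
noncomputable def jetAt {E : X → Type*} [TopologicalSpace (TotalSpace F E)]
    [∀ x, TopologicalSpace (E x)] [FiberBundle F E] (k : ℕ) (x : X) (f : ∀ y, E y) : Jet n k F :=
  fun μ => mderiv μ.1 (locRep F x f) (chartAt (TSp n) x x)

variable (n F) in
/-- The local sections of `E` around `x`: the sections that are smooth in a neighbourhood of `x`
(their values away from `x` are arbitrary and never matter). -/
def LocSec [VectorBundle ℝ F E] [ContMDiffVectorBundle ∞ F E 𝓘(ℝ, TSp n)] (x : X) :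
    Submodule ℝ (∀ y, E y) where
  carrier := {f | ∀ᶠ y in 𝓝 x, ContMDiffAt 𝓘(ℝ, TSp n) (𝓘(ℝ, TSp n).prod 𝓘(ℝ, F)) ∞
    (fun y' => TotalSpace.mk' F y' (f y')) y}
  add_mem' {f g} hf hg := by
    filter_upwards [hf, hg] with y h1 h2
    exact h1.add_section h2
  zero_mem' := Eventually.of_forall fun y => contMDiff_zeroSection ℝ E y
  smul_mem' c f hf := by
    filter_upwards [hf] with y h1
    exact h1.const_smul_section

variable [VectorBundle ℝ F E] [ContMDiffVectorBundle ∞ F E 𝓘(ℝ, TSp n)]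
  [IsManifold 𝓘(ℝ, TSp n) ∞ X]

variable {E}

theorem locRep_apply_chart {x y : X} (hy : y ∈ (chartAt (TSp n) x).source) (f : ∀ y, E y) :
    locRep F x f (chartAt (TSp n) x y) = (trivializationAt F E x ⟨y, f y⟩).2 := by
  simp only [locRep]
  rw [(chartAt (TSp n) x).left_inv hy]

theorem mem_locSec_iff {x : X} {f : ∀ y, E y} :
    f ∈ LocSec n F E x ↔ SmoothNear (locRep F x f) (chartAt (TSp n) x x) := by
  have hb : ∀ᶠ y in 𝓝 x, y ∈ (trivializationAt F E x).baseSet :=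
    (trivializationAt F E x).open_baseSet.mem_nhds (FiberBundle.mem_baseSet_trivializationAt' x)
  have hs : ∀ᶠ y in 𝓝 x, y ∈ (chartAt (TSp n) x).source :=
    (chartAt (TSp n) x).open_source.mem_nhds (mem_chart_source _ x)
  have key : ∀ y, y ∈ (trivializationAt F E x).baseSet → y ∈ (chartAt (TSp n) x).source →
      (ContMDiffAt 𝓘(ℝ, TSp n) (𝓘(ℝ, TSp n).prod 𝓘(ℝ, F)) ∞
        (fun y' => TotalSpace.mk' F y' (f y')) y ↔
        ContDiffAt ℝ ∞ (locRep F x f) (chartAt (TSp n) x y)) := by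
    intro y hyb hys
    rw [(trivializationAt F E x).contMDiffAt_section_iff hyb, ← contMDiffAt_iff_contDiffAt]
    constructor
    · intro h
      have hc : ContMDiffAt 𝓘(ℝ, TSp n) 𝓘(ℝ, TSp n) ∞ (chartAt (TSp n) x).symm
          (chartAt (TSp n) x y) :=
        (contMDiffOn_symm_of_mem_maximalAtlas (IsManifold.chart_mem_maximalAtlas x)).contMDiffAt
          ((chartAt (TSp n) x).open_target.mem_nhds ((chartAt (TSp n) x).map_source hys))
      have h' : ContMDiffAt 𝓘(ℝ, TSp n) 𝓘(ℝ, F) ∞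
          (fun y' => (trivializationAt F E x ⟨y', f y'⟩).2)
          ((chartAt (TSp n) x).symm (chartAt (TSp n) x y)) := by
        rwa [(chartAt (TSp n) x).left_inv hys]
      exact h'.comp _ hc
    · intro h
      have hc : ContMDiffAt 𝓘(ℝ, TSp n) 𝓘(ℝ, TSp n) ∞ (chartAt (TSp n) x) y :=
        contMDiffAt_of_mem_maximalAtlas (IsManifold.chart_mem_maximalAtlas x) hys
      refine (h.comp y hc).congr_of_eventuallyEq ?_
      filter_upwards [(chartAt (TSp n) x).open_source.mem_nhds hys] with y' hy'
      exact (locRep_apply_chart hy' f).symm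
  constructor
  · intro h
    have h1 : ∀ᶠ z in 𝓝 (chartAt (TSp n) x x), z ∈ (chartAt (TSp n) x).target :=
      (chartAt (TSp n) x).open_target.mem_nhds (mem_chart_target _ x)
    have hc : Tendsto (chartAt (TSp n) x).symm (𝓝 (chartAt (TSp n) x x)) (𝓝 x) := by
      have := (chartAt (TSp n) x).symm.continuousAt (x := chartAt (TSp n) x x)
        (mem_chart_target _ x)
      rwa [ContinuousAt, (chartAt (TSp n) x).left_inv (mem_chart_source _ x)] at this
    change ∀ᶠ y in 𝓝 x, _ at h
    filter_upwards [hc.eventually h, hc.eventually hb, hc.eventually hs, h1] with z h2 h3 h4 h5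
    have := (key _ h3 h4).1 h2
    rwa [(chartAt (TSp n) x).right_inv h5] at this
  · intro h
    have hc : Tendsto (chartAt (TSp n) x) (𝓝 x) (𝓝 (chartAt (TSp n) x x)) :=
      (chartAt (TSp n) x).continuousAt (mem_chart_source _ x)
    change ∀ᶠ y in 𝓝 x, _
    filter_upwards [hc.eventually h, hb, hs] with y h2 h3 h4
    exact (key y h3 h4).2 h2

theorem eventually_baseSet_symm (x : X) : ∀ᶠ z in 𝓝 (chartAt (TSp n) x x),
    (chartAt (TSp n) x).symm z ∈ (trivializationAt F E x).baseSet := by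
  have hc := (chartAt (TSp n) x).symm.continuousAt (x := chartAt (TSp n) x x)
    (mem_chart_target _ x)
  rw [ContinuousAt, (chartAt (TSp n) x).left_inv (mem_chart_source _ x)] at hc
  exact hc.eventually ((trivializationAt F E x).open_baseSet.mem_nhds
    (FiberBundle.mem_baseSet_trivializationAt' x))

theorem locRep_add (x : X) (f g : ∀ y, E y) :
    locRep F x (f + g) =ᶠ[𝓝 (chartAt (TSp n) x x)] locRep F x f + locRep F x g := by
  filter_upwards [eventually_baseSet_symm (F := F) (E := E) x] with z hz
  exact ((trivializationAt F E x).linear ℝ hz).1 _ _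

theorem locRep_smul (x : X) (c : ℝ) (f : ∀ y, E y) :
    locRep F x (c • f) =ᶠ[𝓝 (chartAt (TSp n) x x)] c • locRep F x f := by
  filter_upwards [eventually_baseSet_symm (F := F) (E := E) x] with z hz
  exact ((trivializationAt F E x).linear ℝ hz).2 _ _

theorem jetAt_congr (k : ℕ) {x : X} {f g : ∀ y, E y} (h : ∀ᶠ y in 𝓝 x, f y = g y) :
    (jetAt k x f : Jet n k F) = jetAt k x g := by
  have hc := (chartAt (TSp n) x).symm.continuousAt (x := chartAt (TSp n) x x)
    (mem_chart_target _ x)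
  rw [ContinuousAt, (chartAt (TSp n) x).left_inv (mem_chart_source _ x)] at hc
  have hfg : locRep F x f =ᶠ[𝓝 (chartAt (TSp n) x x)] locRep F x g := by
    filter_upwards [hc.eventually h] with z hz
    simp only [locRep, hz]
  funext μ
  exact (pderivList_congr hfg _).self_of_nhds

theorem jetAt_add (k : ℕ) {x : X} {f g : ∀ y, E y} (hf : f ∈ LocSec n F E x)
    (hg : g ∈ LocSec n F E x) :
    (jetAt k x (f + g) : Jet n k F) = jetAt k x f + jetAt k x g := by
  funext μ
  exact ((pderivList_congr (locRep_add x f g) _).trans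
    (pderivList_add (mem_locSec_iff.1 hf) (mem_locSec_iff.1 hg) _)).self_of_nhds

theorem jetAt_smul (k : ℕ) {x : X} (c : ℝ) {f : ∀ y, E y} (hf : f ∈ LocSec n F E x) :
    (jetAt k x (c • f) : Jet n k F) = c • jetAt k x f := by
  funext μ
  exact ((pderivList_congr (locRep_smul x c f) _).trans
    (pderivList_smul (mem_locSec_iff.1 hf) c _)).self_of_nhds

variable (n F E) in
/-- `f ↦ j_k(f)(x)`, on the local sections around `x`. -/
noncomputable def jetL (k : ℕ) (x : X) : LocSec n F E x →ₗ[ℝ] Jet n k F where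
  toFun f := jetAt k x f.1
  map_add' f g := jetAt_add k f.2 g.2
  map_smul' c f := jetAt_smul k c f.2

end OneBundle

/-! ### Systems of partial differential equations -/

variable [IsManifold 𝓘(ℝ, TSp n) ∞ X]
  {F : Type*} [NormedAddCommGroup F] [NormedSpace ℝ F]
  {E : X → Type*} [TopologicalSpace (TotalSpace F E)]
  [∀ x, AddCommGroup (E x)] [∀ x, Module ℝ (E x)] [∀ x, TopologicalSpace (E x)]
  [FiberBundle F E] [VectorBundle ℝ F E] [ContMDiffVectorBundle ∞ F E 𝓘(ℝ, TSp n)]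
  {G : Type*} [NormedAddCommGroup G] [NormedSpace ℝ G]
  {F₀ : X → Type*} [TopologicalSpace (TotalSpace G F₀)]
  [∀ x, AddCommGroup (F₀ x)] [∀ x, Module ℝ (F₀ x)] [∀ x, TopologicalSpace (F₀ x)]
  [FiberBundle G F₀] [VectorBundle ℝ G F₀] [ContMDiffVectorBundle ∞ G F₀ 𝓘(ℝ, TSp n)]

variable (n F E G F₀) in
/-- A smooth epimorphism of vector bundles `Φ : J_q(E) → F₀`, that is, a system `R_q = ker Φ ⊆ J_q(E)`
of order `q` on `E` together with the identification `J_q(E) / R_q = F₀`. Smoothness says that, in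
the local coordinates around each point, the operator `f ↦ Φ(j_q(f))` has the form
`∑_{|μ| ≤ q} a_μ(z) ∂_μ f(z)` with smooth matrices `a_μ`. -/
structure PDESystem (q : ℕ) where
  Φ : ∀ x : X, Jet n q F →ₗ[ℝ] F₀ x
  surjective : ∀ x, Function.Surjective (Φ x)
  smooth : ∀ x : X, ∃ U ∈ 𝓝 (chartAt (TSp n) x x), ∃ a : MIdxLE n q → TSp n → (F →L[ℝ] G),
    (∀ μ, ∀ z ∈ U, ContDiffAt ℝ ∞ (a μ) z) ∧
    ∀ z ∈ U, ∀ f ∈ LocSec n F E ((chartAt (TSp n) x).symm z),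
      locRep G x (fun y => Φ y (jetAt q y f)) z = ∑ μ, a μ z (mderiv μ.1 (locRep F x f) z)

namespace PDESystem

variable {q : ℕ} (S : PDESystem n F E G F₀ q)

/-- The operator `𝒟 = Φ ∘ j_q : E → F₀`. -/
noncomputable def op (f : ∀ y, E y) : ∀ y, F₀ y := fun y => S.Φ y (jetAt q y f)

theorem op_mem {x : X} {f : ∀ y, E y} (hf : f ∈ LocSec n F E x) : S.op f ∈ LocSec n G F₀ x := by
  rw [mem_locSec_iff]
  obtain ⟨U, hU, a, ha, h⟩ := S.smooth x
  have hf' := mem_locSec_iff.1 hf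
  have hc := (chartAt (TSp n) x).symm.continuousAt (x := chartAt (TSp n) x x)
    (mem_chart_target _ x)
  rw [ContinuousAt, (chartAt (TSp n) x).left_inv (mem_chart_source _ x)] at hc
  have hloc : ∀ᶠ z in 𝓝 (chartAt (TSp n) x x),
      f ∈ LocSec n F E ((chartAt (TSp n) x).symm z) :=
    hc.eventually (eventually_eventually_nhds.2 hf)
  have heq : locRep G x (S.op f) =ᶠ[𝓝 (chartAt (TSp n) x x)]
      fun z => ∑ μ, a μ z (mderiv μ.1 (locRep F x f) z) := by
    filter_upwards [hU, hloc] with z h1 h2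
    exact h z h1 f h2
  filter_upwards [eventually_eventually_nhds.2 heq, hU, hf'.eventually] with z h1 h2 h3
  refine ContDiffAt.congr_of_eventuallyEq (ContDiffAt.sum fun μ _ => ?_) h1
  exact (ha μ z h2).clm_apply (h3.mderiv μ.1).self_of_nhds

theorem op_add {x : X} {f g : ∀ y, E y} (hf : f ∈ LocSec n F E x) (hg : g ∈ LocSec n F E x) :
    ∀ᶠ y in 𝓝 x, S.op (f + g) y = (S.op f + S.op g) y := by
  filter_upwards [eventually_eventually_nhds.2 hf, eventually_eventually_nhds.2 hg] with y h1 h2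
  change S.Φ y (jetAt q y (f + g)) = S.Φ y (jetAt q y f) + S.Φ y (jetAt q y g)
  rw [jetAt_add (F := F) q h1 h2, map_add]

theorem op_smul {x : X} (c : ℝ) {f : ∀ y, E y} (hf : f ∈ LocSec n F E x) :
    ∀ᶠ y in 𝓝 x, S.op (c • f) y = (c • S.op f) y := by
  filter_upwards [eventually_eventually_nhds.2 hf] with y h1
  change S.Φ y (jetAt q y (c • f)) = c • S.Φ y (jetAt q y f)
  rw [jetAt_smul (F := F) q c h1, map_smul]

/-- `f ↦ j_r(𝒟 f)(x)`, on the local sections of `E` around `x`. -/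
noncomputable def jetOp (r : ℕ) (x : X) : LocSec n F E x →ₗ[ℝ] Jet n r G where
  toFun f := jetAt r x (S.op f.1)
  map_add' f g := (jetAt_congr r (S.op_add f.2 g.2)).trans
    (jetAt_add r (S.op_mem f.2) (S.op_mem g.2))
  map_smul' c f := (jetAt_congr r (S.op_smul c f.2)).trans (jetAt_smul r c (S.op_mem f.2))

/-- The fibre at `x` of `R_q = ker Φ ⊆ J_q(E)`. -/
def R₀ (x : X) : Submodule ℝ (Jet n q F) := LinearMap.ker (S.Φ x)

/-- The fibre at `x` of the `r`-th prolongation `R_{q+r} = ker ρ_r(Φ) ⊆ J_{q+r}(E)`, where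
`ρ_r(Φ) : J_{q+r}(E) → J_r(F₀)` is the map `j_{q+r}(f) ↦ j_r(𝒟 f)`. -/
noncomputable def R (r : ℕ) (x : X) : Submodule ℝ (Jet n (q + r) F) :=
  (LinearMap.ker (S.jetOp r x)).map (jetL n F E (q + r) x)

/-- The fibre at `x` of `B_r = im ρ_r(Φ) ⊆ J_r(F₀)`. -/
noncomputable def B (r : ℕ) (x : X) : Submodule ℝ (Jet n r G) :=
  LinearMap.range (S.jetOp r x)

/-- Formal integrability: the `R_{q+r}` have locally constant rank (they are vector bundles) and the
projections `R_{q+r+1} → R_{q+r}` are onto, for all `r ≥ 0`. -/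
def FormallyIntegrable : Prop :=
  ∀ r : ℕ, IsLocallyConstant (fun x => Module.finrank ℝ (S.R r x)) ∧
    ∀ x, (S.R (r + 1) x).map (jetProj n (q + r) F) = S.R r x

/-- The symbol `g_q = R_q ∩ (S_q T* ⊗ E)` at `x`. -/
def g (x : X) : Submodule ℝ (SymT n q F) := symbolOf (S.R₀ x)

/-- `σ(Φ) : S_q T* ⊗ E → F₀` at `x`, the restriction of `Φ`. -/
noncomputable def σ₀ (x : X) : SymT n q F →ₗ[ℝ] G :=
  (trivializationAt G F₀ x).linearMapAt ℝ x ∘ₗ S.Φ x ∘ₗ jetTop n q F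

/-- `σ_r(Φ) : S_{q+r} T* ⊗ E → S_r T* ⊗ F₀` at `x`, `(σ_r(Φ) v)_ν = σ(Φ)((v_{μ + ν})_μ)`. -/
noncomputable def σ (r : ℕ) (x : X) : SymT n (q + r) F →ₗ[ℝ] SymT n r G where
  toFun v ν := S.σ₀ x fun μ => v (μ.add ν)
  map_add' v v' := by funext ν; exact (S.σ₀ x).map_add _ _
  map_smul' c v := by funext ν; exact (S.σ₀ x).map_smul c _

/-- `h_r = im σ_r(Φ) ⊆ S_r T* ⊗ F₀` at `x`. -/
noncomputable def h (r : ℕ) (x : X) : Submodule ℝ (SymT n r G) := LinearMap.range (S.σ r x)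

/-- The symbol `B_k ∩ (S_k T* ⊗ F₀)` at `x` of the operator
`𝒟₁ = Ψ ∘ j_k : F₀ → F₁` of compatibility conditions of order `k`, where
`Ψ : J_k(F₀) → J_k(F₀) / B_k = F₁` is the canonical projection. -/
noncomputable def ccSymbol (k : ℕ) (x : X) : Submodule ℝ (SymT n k G) := symbolOf (S.B k x)

end PDESystem
end Bundles

/-!
The image `h_r` of the symbol map sits in an exact sequence
`0 → g_{q+r} → S_{q+r} T* ⊗ E → h_r → 0`, compatible with the Spencer maps. The complex in the middle is
exact in positive form degree (`exists_spencerDelta_eq`): the Euler homotopy multiplies a cocycle by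
its total degree. So a cocycle with values in `h` lifts to a form on the middle term, the Spencer
differential of the lift is a cocycle with values in `g` one form degree higher and one polynomial
degree lower, and if that cocycle is a coboundary, the lift can be corrected to a closed, hence exact,
form (`mem_map_spencerDelta_range`).

Applied to the closed `1`-form `δ w`, this shows that `2`-acyclicity of `g_{q+s}` forces the
prolongations of `h_{s+1}` to be the later images `h_{s+1+r}` (`prolong_range_symbolMap`). Applied to
`1`- and `2`-forms, it turns `3`-acyclicity of `g_{q+s+s'}` into `2`-acyclicity of `h_{s+s'+1}`
(`isAcyclic_range_symbolMap`).

It remains to identify the symbol `B_{s+1} ∩ (S_{s+1} T* ⊗ F₀)` with `h_{s+1}`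
(`PDESystem.ccSymbol_eq_h`), which is where formal integrability is used. The analytic input is that
`j_r(𝒟 f)(x) = σ_r(Φ)(∂^{q+r} f(x))` when the derivatives of `f` of order less than `q + r` vanish at `x`
(`PDESystem.jetAt_op_of_vanishing`), together with the existence of local sections with a
prescribed top-order jet.
-/

/-! ### Contraction and multiplication of symmetric tensors -/

section SymmetricTensors

variable {n : ℕ} {W : Type*} [AddCommGroup W] [Module ℝ W]

theorem contr_succ_apply {k : ℕ} (ξ : TSp n) (v : SymT n (k + 1) W) (μ : MIdx n k) :
    contr (k + 1) ξ v μ = ∑ i, ξ i • v (μ.succ i) := rfl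

theorem contr_single {k : ℕ} (i : Fin n) (v : SymT n (k + 1) W) (μ : MIdx n k) :
    contr (k + 1) (EuclideanSpace.single i 1) v μ = v (μ.succ i) := by
  rw [contr_succ_apply, Finset.sum_eq_single i] <;> simp +contextual

theorem MIdx.succ_comm {k : ℕ} (μ : MIdx n k) (i j : Fin n) :
    (μ.succ i).succ j = (μ.succ j).succ i :=
  Subtype.ext (add_right_comm _ _ _)

/-- `μ - 1ᵢ + 1ᵢ = μ` if `μᵢ ≠ 0` (the subtraction is truncated). -/
theorem sub_single_add_single {μ : Fin n → ℕ} {i : Fin n} (h : μ i ≠ 0) :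
    μ - Pi.single i 1 + Pi.single i 1 = μ :=
  tsub_add_cancel_of_le fun l => by
    by_cases hl : l = i
    · subst hl
      simpa using Nat.one_le_iff_ne_zero.2 h
    · simp [hl]

theorem MIdx.exists_succ {k : ℕ} (μ : MIdx n (k + 1)) :
    ∃ (i : Fin n) (ν : MIdx n k), ν.succ i = μ := by
  obtain ⟨i, -, hi⟩ : ∃ i ∈ Finset.univ, μ.1 i ≠ 0 :=
    Finset.exists_ne_zero_of_sum_ne_zero (by rw [μ.2]; exact Nat.succ_ne_zero k)
  have h : μ.1 - Pi.single i 1 + Pi.single i 1 = μ.1 := sub_single_add_single hi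
  have hs := congrArg (fun m : Fin n → ℕ => ∑ l, m l) h
  simp only [Pi.add_apply, Finset.sum_add_distrib, Finset.sum_pi_single', Finset.mem_univ,
    if_true, μ.2] at hs
  exact ⟨i, ⟨μ.1 - Pi.single i 1, by simpa using hs⟩, Subtype.ext h⟩

theorem contr_comm (k : ℕ) (ξ η : TSp n) (v : SymT n (k + 1) W) :
    contr k ξ (contr (k + 1) η v) = contr k η (contr (k + 1) ξ v) := by
  cases k with
  | zero => rfl
  | succ k =>
    funext μ
    change ∑ i, ξ i • ∑ j, η j • v ((μ.succ i).succ j) =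
      ∑ i, η i • ∑ j, ξ j • v ((μ.succ i).succ j)
    simp only [Finset.smul_sum]
    rw [Finset.sum_comm]
    refine Finset.sum_congr rfl fun i _ => Finset.sum_congr rfl fun j _ => ?_
    rw [smul_comm, MIdx.succ_comm]

theorem eq_zero_of_contr_eq_zero {k : ℕ} {v : SymT n (k + 1) W}
    (h : ∀ ξ, contr (k + 1) ξ v = 0) : v = 0 := by
  funext μ
  obtain ⟨i, ν, rfl⟩ := μ.exists_succ
  rw [← contr_single i v ν, h]
  rfl

/-- The extension of a symmetric tensor by zero to the multi-indices of all lengths. -/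
def SymT.extend {k : ℕ} (v : SymT n k W) (μ : Fin n → ℕ) : W :=
  if h : ∑ i, μ i = k then v ⟨μ, h⟩ else 0

theorem SymT.extend_apply {k : ℕ} (v : SymT n k W) (μ : MIdx n k) : v.extend μ.1 = v μ :=
  dif_pos μ.2

theorem SymT.extend_contr {k : ℕ} (ξ : TSp n) (v : SymT n (k + 1) W) (μ : Fin n → ℕ) :
    SymT.extend (k := k) (W := W) (contr (W := W) (k + 1) ξ v) μ =
      ∑ i, ξ i • v.extend (μ + Pi.single i 1) := by
  by_cases h : ∑ i, μ i = k
  · rw [SymT.extend, dif_pos h]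
    refine (contr_succ_apply ξ v ⟨μ, h⟩).trans (Finset.sum_congr rfl fun i _ => ?_)
    exact congrArg (ξ i • ·) (SymT.extend_apply v (MIdx.succ ⟨μ, h⟩ i)).symm
  · rw [SymT.extend, dif_neg h]
    refine (Finset.sum_eq_zero fun i _ => ?_).symm
    rw [SymT.extend, dif_neg, smul_zero]
    simpa [Finset.sum_add_distrib] using h

/-- The symmetric product with the `i`-th coordinate covector. In the convention where `v_μ` stands
for `∂_μ f`, this is the multiplication of `f` by the `i`-th coordinate:
`(xᵢ v)_μ = μᵢ v_{μ - 1ᵢ}`. The truncated subtraction at `μᵢ = 0` is harmless because of the factor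
`μᵢ`. -/
def mulCoord (i : Fin n) (k : ℕ) : SymT n k W →ₗ[ℝ] SymT n (k + 1) W where
  toFun v μ := (μ.1 i : ℝ) • v.extend (μ.1 - Pi.single i 1)
  map_add' v v' := by
    funext μ
    simp only [SymT.extend, Pi.add_apply]
    split_ifs <;> simp
  map_smul' c v := by
    funext μ
    simp only [SymT.extend, Pi.smul_apply, RingHom.id_apply]
    split_ifs <;> simp [smul_comm c]

theorem mulCoord_apply (i : Fin n) {k : ℕ} (v : SymT n k W) (μ : MIdx n (k + 1)) :
    mulCoord i k v μ = (μ.1 i : ℝ) • v.extend (μ.1 - Pi.single i 1) := rfl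

/-- The Leibniz rule for the contraction of a product with a coordinate. -/
theorem contr_mulCoord (ξ : TSp n) (i : Fin n) {k : ℕ} (v : SymT n (k + 1) W) :
    contr (k + 2) ξ (mulCoord i (k + 1) v) = mulCoord i k (contr (k + 1) ξ v) + ξ i • v := by
  funext μ
  change contr (k + 1 + 1) ξ (mulCoord i (k + 1) v) μ =
    mulCoord i k (contr (k + 1) ξ v) μ + ξ i • v μ
  have hv : ξ i • v μ = ∑ l, if l = i then ξ i • v μ else 0 := by simp
  rw [contr_succ_apply, mulCoord_apply, SymT.extend_contr, Finset.smul_sum, hv,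
    ← Finset.sum_add_distrib]
  refine Finset.sum_congr rfl fun l _ => ?_
  rw [mulCoord_apply]
  change ξ l • (((μ.1 + Pi.single l 1 : Fin n → ℕ) i : ℕ) : ℝ) •
    v.extend (μ.1 + Pi.single l 1 - Pi.single i 1)
    = _
  by_cases hl : l = i
  · subst hl
    rw [if_pos rfl, add_tsub_cancel_right, SymT.extend_apply]
    by_cases h0 : μ.1 l = 0
    · simp [h0]
    · rw [sub_single_add_single h0, SymT.extend_apply]
      simp only [Pi.add_apply, Pi.single_eq_same, Nat.cast_add, Nat.cast_one, add_smul, smul_add,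
        one_smul]
      rw [smul_comm]
  · rw [if_neg hl, add_zero, smul_comm]
    have h1 : (μ.1 + Pi.single l 1 : Fin n → ℕ) i = μ.1 i := by simp [Ne.symm hl]
    rw [h1]
    by_cases h0 : μ.1 i = 0
    · simp [h0]
    · have : μ.1 + Pi.single l 1 - Pi.single i 1 = μ.1 - Pi.single i 1 + Pi.single l 1 := by
        funext j
        by_cases hj : j = i
        · subst hj
          simp [Ne.symm hl]
        · simp [hj]
      rw [this]

/-- Euler's identity for homogeneous polynomials. -/
theorem sum_mulCoord_contr {k : ℕ} (v : SymT n (k + 1) W) :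
    ∑ i, mulCoord i k (contr (k + 1) (EuclideanSpace.single i 1) v) = ((k + 1 : ℕ) : ℝ) • v := by
  funext μ
  have hk : ((k + 1 : ℕ) : ℝ) • v μ = ∑ i, (μ.1 i : ℝ) • v μ := by
    rw [← Finset.sum_smul, ← Nat.cast_sum, μ.2]
  rw [Finset.sum_apply, Pi.smul_apply, hk]
  refine Finset.sum_congr rfl fun i _ => ?_
  rw [mulCoord_apply]
  by_cases h0 : μ.1 i = 0
  · simp [h0]
  · rw [SymT.extend_contr, Finset.sum_eq_single i]
    · rw [sub_single_add_single h0, SymT.extend_apply]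
      simp
    · intro j _ hj
      simp [hj]
    · simp

end SymmetricTensors

/-! ### The Spencer complex of the full symmetric algebra -/

section SpencerComplex

variable {n : ℕ} {W : Type*} [AddCommGroup W] [Module ℝ W]

theorem spencerDelta_apply (i k : ℕ) (α : FormT n i k W) (ξ : Fin (i + 1) → TSp n) :
    spencerDelta (n := n) (W := W) i k α ξ =
      ∑ j : Fin (i + 1), (-1) ^ (j : ℕ) • contr k (ξ j) (α (j.removeNth ξ)) :=
  AlternatingMap.alternatizeUncurryFin_apply _ _

/-- The Spencer maps form a complex, since contractions commute. -/
theorem spencerDelta_spencerDelta (i k : ℕ) (α : FormT n i (k + 1) W) :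
    spencerDelta (n := n) (W := W) (i + 1) k (spencerDelta (n := n) (W := W) i (k + 1) α) = 0 := by
  let f : TSp n →ₗ[ℝ] TSp n →ₗ[ℝ] FormT n i (k - 1) W :=
    LinearMap.mk₂ ℝ (fun ξ η => (contr k ξ ∘ₗ contr (k + 1) η).compAlternatingMap α)
      (fun ξ ξ' η => by ext v : 1; simp)
      (fun c ξ η => by ext v : 1; simp)
      (fun ξ η η' => by ext v : 1; simp)
      (fun c ξ η => by ext v : 1; simp)
  have hf : ∀ ξ η, f ξ η = f η ξ := fun ξ η => by
    ext v : 1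
    exact contr_comm k ξ η (α v)
  rw [← AlternatingMap.alternatizeUncurryFin_alternatizeUncurryFinLM_comp_of_symmetric hf]
  ext ξ : 1
  rw [spencerDelta_apply, AlternatingMap.alternatizeUncurryFin_apply]
  refine Finset.sum_congr rfl fun j _ => ?_
  congr 1
  change _ = AlternatingMap.alternatizeUncurryFin (f (ξ j)) _
  rw [spencerDelta_apply, AlternatingMap.alternatizeUncurryFin_apply, map_sum]
  refine Finset.sum_congr rfl fun l _ => ?_
  rw [map_zsmul]
  rfl

/-- The homotopy operator `κ α = ∑ᵢ xᵢ ι_{eᵢ} α` of the Spencer complex, the contraction with the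
Euler vector field. -/
noncomputable def spencerHomotopy (j k : ℕ) (α : FormT n (j + 1) k W) : FormT n j (k + 1) W :=
  ∑ i, (mulCoord i k).compAlternatingMap (α.curryLeft (EuclideanSpace.single i 1))

theorem spencerHomotopy_apply (j k : ℕ) (α : FormT n (j + 1) k W) (ξ : Fin j → TSp n) :
    spencerHomotopy j k α ξ =
      ∑ i, mulCoord i k (α (Matrix.vecCons (EuclideanSpace.single i 1) ξ)) := by
  have h := map_sum (AddMonoidHom.mk' (fun β : FormT n j (k + 1) W => β ξ) fun _ _ => rfl)
    (fun i => (mulCoord i k).compAlternatingMap (α.curryLeft (EuclideanSpace.single i 1)))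
    Finset.univ
  exact h

theorem sum_smul_map_vecCons_single {V : Type*} [AddCommGroup V] [Module ℝ V] {j : ℕ}
    (α : TSp n [⋀^Fin (j + 1)]→ₗ[ℝ] V) (η : TSp n) (ξ : Fin j → TSp n) :
    ∑ i, η i • α (Matrix.vecCons (EuclideanSpace.single i 1) ξ) = α (Matrix.vecCons η ξ) := by
  have h : η = ∑ i, η i • (EuclideanSpace.single i 1 : TSp n) := by
    ext l
    simp [Finset.sum_apply, Pi.single_apply]
  have key : ∀ ζ : TSp n, α (Matrix.vecCons ζ ξ) = α.curryLeft ζ ξ := fun _ => rfl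
  simp only [key]
  let ev : TSp n →ₗ[ℝ] V :=
    { toFun := fun ζ => α.curryLeft ζ ξ
      map_add' := fun _ _ => by simp
      map_smul' := fun _ _ => by simp }
  have := (congrArg ev h).trans (map_sum ev _ _)
  simp only [map_smul] at this
  exact this.symm

/-- On cocycles the homotopy formula `δ κ + κ δ = form degree + polynomial degree` reduces to its
first term. -/
theorem spencerDelta_spencerHomotopy {j k : ℕ} {α : FormT n (j + 1) (k + 1) W}
    (hα : spencerDelta (n := n) (W := W) (j + 1) (k + 1) α = 0) :
    spencerDelta (n := n) (W := W) j (k + 2) (spencerHomotopy j (k + 1) α) =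
      ((k + 1 + (j + 1) : ℕ) : ℝ) • α := by
  ext ξ : 1
  -- closedness, evaluated on `(eᵢ, ξ₀, …, ξⱼ)`
  have hcl : ∀ i, contr (k + 1) (EuclideanSpace.single i 1) (α ξ) =
      ∑ l : Fin (j + 1), (-1) ^ (l : ℕ) • contr (k + 1) (ξ l)
        (α (Matrix.vecCons (EuclideanSpace.single i 1) (l.removeNth ξ))) := by
    intro i
    have h := congrArg
      (fun β : FormT n _ _ W => β (Matrix.vecCons (EuclideanSpace.single i 1) ξ)) hα
    simp only [spencerDelta_apply] at h
    rw [Fin.sum_univ_succ] at h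
    have h2 : ∀ l : Fin (j + 1),
        l.succ.removeNth (Matrix.vecCons (EuclideanSpace.single i (1 : ℝ)) ξ) =
        Matrix.vecCons (EuclideanSpace.single i (1 : ℝ)) (l.removeNth ξ) := by
      intro l
      funext m
      refine Fin.cases ?_ (fun m => ?_) m <;> simp [Fin.removeNth, Matrix.vecCons]
    have h3 : (0 : Fin (j + 2)).removeNth (Matrix.vecCons (EuclideanSpace.single i (1 : ℝ)) ξ) =
        ξ := by
      funext m
      simp [Fin.removeNth, Matrix.vecCons]
    simp only [h2, h3, Matrix.cons_val_zero, Matrix.cons_val_succ, Fin.val_zero, pow_zero,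
      one_smul, Fin.val_succ, pow_succ, mul_neg, mul_one, neg_smul, Finset.sum_neg_distrib] at h
    exact eq_of_sub_eq_zero (by rw [sub_eq_add_neg]; exact h)
  have hterm : ∀ l : Fin (j + 1),
      contr (k + 2) (ξ l) (spencerHomotopy j (k + 1) α (l.removeNth ξ)) =
      (∑ i, mulCoord i k (contr (k + 1) (ξ l)
        (α (Matrix.vecCons (EuclideanSpace.single i 1) (l.removeNth ξ))))) +
      α (Matrix.vecCons (ξ l) (l.removeNth ξ)) := by
    intro l
    rw [spencerHomotopy_apply, map_sum, ← sum_smul_map_vecCons_single α, ← Finset.sum_add_distrib]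
    exact Finset.sum_congr rfl fun i _ => contr_mulCoord _ _ _
  have hcurry : ∑ l : Fin (j + 1), (-1) ^ (l : ℕ) • α (Matrix.vecCons (ξ l) (l.removeNth ξ)) =
      ((j + 1 : ℕ) : ℝ) • α ξ := by
    have h := congrArg (fun β : FormT n _ _ W => β ξ)
      (AlternatingMap.alternatizeUncurryFin_curryLeft α)
    simp only [AlternatingMap.alternatizeUncurryFin_apply, AlternatingMap.curryLeft_apply_apply,
      AlternatingMap.smul_apply] at h
    rw [h, Nat.cast_smul_eq_nsmul]
  rw [spencerDelta_apply]
  simp only [hterm, smul_add, Finset.sum_add_distrib]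
  rw [hcurry]
  have hE : ∑ l : Fin (j + 1), (-1) ^ (l : ℕ) • ∑ i, mulCoord i k (contr (k + 1) (ξ l)
        (α (Matrix.vecCons (EuclideanSpace.single i 1) (l.removeNth ξ)))) =
      ((k + 1 : ℕ) : ℝ) • α ξ := by
    rw [← sum_mulCoord_contr]
    simp only [hcl, map_sum, Finset.smul_sum]
    rw [Finset.sum_comm]
    refine Finset.sum_congr rfl fun i _ => Finset.sum_congr rfl fun l _ => ?_
    exact (map_zsmul (mulCoord i k) _ _).symm
  rw [AlternatingMap.smul_apply, Nat.cast_add (k + 1), add_smul, ← hE]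

/-- The algebraic Poincaré lemma: the Spencer complex of the full symmetric algebra is exact in
positive form degree. -/
theorem exists_spencerDelta_eq {j k : ℕ} {α : FormT n (j + 1) (k + 1) W}
    (hα : spencerDelta (n := n) (W := W) (j + 1) (k + 1) α = 0) :
    ∃ β : FormT n j (k + 2) W, spencerDelta (n := n) (W := W) j (k + 2) β = α := by
  refine ⟨((k + 1 + (j + 1) : ℕ) : ℝ)⁻¹ • spencerHomotopy j (k + 1) α, ?_⟩
  rw [map_smul, spencerDelta_spencerHomotopy hα, smul_smul, inv_mul_cancel₀, one_smul]
  exact Nat.cast_ne_zero.2 (by omega)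

end SpencerComplex

/-! ### Prolonged symbol maps: acyclicity of kernels and images -/

section SymbolMaps

variable {n q : ℕ} {F G : Type*} [AddCommGroup F] [Module ℝ F] [AddCommGroup G] [Module ℝ G]

/-- The `r`-th prolongation `S_k T* ⊗ F → S_r T* ⊗ G`, `k = q + r`, of a linear map
`φ : S_q T* ⊗ F → G`, given by `v ↦ (φ((v_{μ + ν})_μ))_ν`. Keeping `k` free lets the degree be written
in whichever form the source has. -/
def symbolMap (φ : SymT n q F →ₗ[ℝ] G) {k r : ℕ} (h : k = q + r) :
    SymT n k F →ₗ[ℝ] SymT n r G where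
  toFun v ν := φ fun μ => v ⟨μ.1 + ν.1, by simp [Finset.sum_add_distrib, μ.2, ν.2, h]⟩
  map_add' v v' := by funext ν; exact φ.map_add _ _
  map_smul' c v := by funext ν; exact φ.map_smul c _

theorem symbolMap_contr (φ : SymT n q F →ₗ[ℝ] G) {k r : ℕ} (h : k = q + r)
    (h' : k + 1 = q + (r + 1)) (ξ : TSp n) (v : SymT n (k + 1) F) :
    symbolMap φ h (contr (W := F) (k + 1) ξ v) = contr (W := G) (r + 1) ξ (symbolMap φ h' v) := by
  funext ν
  change φ _ = ∑ i, ξ i • φ _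
  simp only [← map_smul, ← map_sum]
  congr 1
  funext μ
  rw [Finset.sum_apply]
  refine (contr_succ_apply ξ v _).trans (Finset.sum_congr rfl fun i _ => ?_)
  exact congrArg (fun m => ξ i • v m) (Subtype.ext (add_assoc _ _ _))

theorem symbolMap_spencerDelta (φ : SymT n q F →ₗ[ℝ] G) {k r : ℕ} (h : k = q + r)
    (h' : k + 1 = q + (r + 1)) (i : ℕ) (α : FormT n i (k + 1) F) :
    (symbolMap φ h).compAlternatingMap (spencerDelta (n := n) (W := F) i (k + 1) α) =
      spencerDelta (n := n) (W := G) i (r + 1) ((symbolMap φ h').compAlternatingMap α) := by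
  ext ξ : 1
  rw [LinearMap.compAlternatingMap_apply, spencerDelta_apply, spencerDelta_apply, map_sum]
  refine Finset.sum_congr rfl fun j _ => ?_
  rw [map_zsmul]
  exact congrArg _ (symbolMap_contr φ h h' _ _)

theorem mem_prolongOne {k : ℕ} {g : Submodule ℝ (SymT n k F)} {v : SymT n (k + 1) F} :
    v ∈ prolongOne g ↔ ∀ ξ, contr (k + 1) ξ v ∈ g := by
  simp only [prolongOne, Submodule.mem_iInf, Submodule.mem_comap]

theorem prolongOne_ker_symbolMap (φ : SymT n q F →ₗ[ℝ] G) {k r : ℕ} (h : k = q + r)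
    (h' : k + 1 = q + (r + 1)) :
    prolongOne (LinearMap.ker (symbolMap φ h)) = LinearMap.ker (symbolMap φ h') := by
  ext v
  simp only [mem_prolongOne, LinearMap.mem_ker, symbolMap_contr φ h h']
  refine ⟨eq_zero_of_contr_eq_zero, fun hv ξ => ?_⟩
  rw [hv, map_zero]

theorem prolong_ker_symbolMap (φ : SymT n q F →ₗ[ℝ] G) {k r : ℕ} (h : k = q + r) (t : ℕ) {r' : ℕ}
    (h' : k + t = q + r') :
    prolong (LinearMap.ker (symbolMap φ h)) t = LinearMap.ker (symbolMap φ h') := by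
  induction t generalizing r' with
  | zero =>
    obtain rfl : r' = r := by omega
    rfl
  | succ t ih =>
    obtain ⟨r', rfl⟩ : ∃ r'', r' = r'' + 1 := ⟨r + t, by omega⟩
    rw [prolong, ih (r' := r') (by omega)]
    exact prolongOne_ker_symbolMap φ _ _

theorem ker_symbolMap_zero (φ : SymT n q F →ₗ[ℝ] G) :
    LinearMap.ker (symbolMap φ (add_zero q).symm) = LinearMap.ker φ := by
  ext v
  simp only [LinearMap.mem_ker]
  have hν : ∀ ν : MIdx n 0, ν.1 = 0 := fun ν => by
    funext i
    exact (Finset.sum_eq_zero_iff.1 ν.2) i (Finset.mem_univ i)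
  have key : ∀ ν : MIdx n 0, symbolMap φ (add_zero q).symm v ν = φ v := by
    intro ν
    change φ _ = φ v
    congr 1
    funext μ
    exact congrArg v (Subtype.ext ((congrArg (μ.1 + ·) (hν ν)).trans (add_zero _)))
  constructor
  · intro h
    rw [← key ⟨0, by simp⟩, h]
    rfl
  · intro h
    funext ν
    rw [key, h]
    rfl

theorem prolong_ker (φ : SymT n q F →ₗ[ℝ] G) (t : ℕ) {r : ℕ} (h : q + t = q + r) :
    prolong (LinearMap.ker φ) t = LinearMap.ker (symbolMap φ h) := by
  rw [← ker_symbolMap_zero]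
  exact prolong_ker_symbolMap φ _ t h

/-- A form with values in the range of a linear map lifts along it. -/
theorem exists_compAlternatingMap_eq {A B V ι : Type*} [AddCommGroup A] [Module ℝ A]
    [AddCommGroup B] [Module ℝ B] [AddCommGroup V] [Module ℝ V] (f : A →ₗ[ℝ] B)
    (β : V [⋀^ι]→ₗ[ℝ] B) (hβ : ∀ ξ, β ξ ∈ LinearMap.range f) :
    ∃ α : V [⋀^ι]→ₗ[ℝ] A, f.compAlternatingMap α = β := by
  obtain ⟨g, hg⟩ := f.rangeRestrict.exists_rightInverse_of_surjective f.range_rangeRestrict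
  refine ⟨g.compAlternatingMap (β.codRestrict _ hβ), ?_⟩
  ext ξ : 1
  have := congrArg Subtype.val (LinearMap.congr_fun hg ⟨β ξ, hβ ξ⟩)
  exact this

/-- The connecting homomorphism of `0 → g → S T* ⊗ F → h → 0`, where `g` and `h` are the kernels and
the images of the prolongations of `φ`: since the middle complex is exact, the Spencer cohomology of
`h` in form degree `j + 1` vanishes as soon as that of `g` does in form degree `j + 2`, one
polynomial degree lower. -/
theorem mem_map_spencerDelta_range (φ : SymT n q F →ₗ[ℝ] G) {j K M : ℕ} (h₀ : K = q + M)
    (h₁ : K + 1 = q + (M + 1)) (h₂ : K + 2 = q + (M + 2))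
    (hex : formsIn (j + 2) (LinearMap.ker (symbolMap φ h₀)) ⊓
      LinearMap.ker (spencerDelta (n := n) (W := F) (j + 2) K) ≤
      (formsIn (j + 1) (LinearMap.ker (symbolMap φ h₁))).map
        (spencerDelta (n := n) (W := F) (j + 1) (K + 1)))
    {β : FormT n (j + 1) (M + 1) G} (hβ : β ∈ formsIn (j + 1) (LinearMap.range (symbolMap φ h₁)))
    (hδ : spencerDelta (n := n) (W := G) (j + 1) (M + 1) β = 0) :
    β ∈ (formsIn j (LinearMap.range (symbolMap φ h₂))).map
      (spencerDelta (n := n) (W := G) j (M + 2)) := by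
  obtain ⟨α, rfl⟩ := exists_compAlternatingMap_eq _ β hβ
  -- `δ α` has values in the kernel because `β` is closed; `γ` corrects `α` to a closed form
  obtain ⟨γ, hγ, hγα⟩ := hex (x := spencerDelta (n := n) (W := F) (j + 1) (K + 1) α) ⟨fun ξ => by
    rw [LinearMap.mem_ker, ← LinearMap.compAlternatingMap_apply]
    exact congrArg (fun θ : FormT n _ _ G => θ ξ) ((symbolMap_spencerDelta φ h₀ h₁ _ α).trans hδ),
    spencerDelta_spencerDelta _ _ _⟩
  obtain ⟨η, hη⟩ := exists_spencerDelta_eq (α := α - γ) (by rw [map_sub, hγα, sub_self])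
  refine ⟨(symbolMap φ h₂).compAlternatingMap η, fun ξ => ⟨η ξ, rfl⟩, ?_⟩
  refine (symbolMap_spencerDelta φ h₁ h₂ j η).symm.trans ?_
  ext ξ : 1
  have hz : symbolMap φ h₁ (γ ξ) = 0 := hγ ξ
  rw [LinearMap.compAlternatingMap_apply, LinearMap.compAlternatingMap_apply]
  have : spencerDelta (n := n) (W := F) j (K + 2) η ξ = α ξ - γ ξ :=
    congrArg (fun θ : FormT n _ _ F => θ ξ) hη
  change symbolMap φ h₁ (spencerDelta (n := n) (W := F) j (K + 2) η ξ) = _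
  rw [this, map_sub, hz, sub_zero]

theorem spencerDelta_constOfIsEmpty {k : ℕ} (v : SymT n k F) (ξ : Fin 1 → TSp n) :
    spencerDelta (n := n) (W := F) 0 k (AlternatingMap.constOfIsEmpty ℝ (TSp n) (Fin 0) v) ξ =
      contr k (ξ 0) v := by
  simp [spencerDelta_apply]

/-- If the second Spencer cohomology of the kernel vanishes, then prolonging the image of a
prolongation of `φ` gives the image of the next one. -/
theorem prolongOne_range_symbolMap (φ : SymT n q F →ₗ[ℝ] G) {K M : ℕ} (h₀ : K = q + M)
    (h₁ : K + 1 = q + (M + 1)) (h₂ : K + 2 = q + (M + 2))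
    (hex : formsIn 2 (LinearMap.ker (symbolMap φ h₀)) ⊓
      LinearMap.ker (spencerDelta (n := n) (W := F) 2 K) ≤
      (formsIn 1 (LinearMap.ker (symbolMap φ h₁))).map
        (spencerDelta (n := n) (W := F) 1 (K + 1))) :
    prolongOne (LinearMap.range (symbolMap φ h₁)) = LinearMap.range (symbolMap φ h₂) := by
  refine le_antisymm (fun w hw => ?_) ?_
  · rw [mem_prolongOne] at hw
    -- `w`, viewed as a `0`-form, has the closed form `δ w` with values in the image as differential
    obtain ⟨η, hη, hηw⟩ := mem_map_spencerDelta_range φ (j := 0) h₀ h₁ h₂ hex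
      (β := spencerDelta (n := n) (W := G) 0 (M + 2)
        (AlternatingMap.constOfIsEmpty ℝ (TSp n) (Fin 0) w))
      (fun ξ => by rw [spencerDelta_constOfIsEmpty]; exact hw (ξ 0))
      (spencerDelta_spencerDelta 0 (M + 1) _)
    have hc : η = AlternatingMap.constOfIsEmpty ℝ (TSp n) (Fin 0) (η 0) := by
      ext ξ : 1
      rw [Subsingleton.elim ξ 0]
      rfl
    have : w = η 0 := by
      refine eq_of_sub_eq_zero (eq_zero_of_contr_eq_zero (k := M + 1) fun ξ => ?_)
      have h := congrArg (fun θ : FormT n _ _ G => θ fun _ => ξ) hηw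
      rw [hc] at h
      have h' : contr (M + 2) ξ (η 0) = contr (M + 2) ξ w :=
        (spencerDelta_constOfIsEmpty _ _).symm.trans (h.trans (spencerDelta_constOfIsEmpty _ _))
      exact (map_sub _ _ _).trans (sub_eq_zero.2 h'.symm)
    rw [this]
    exact hη 0
  · rintro _ ⟨v, rfl⟩
    rw [mem_prolongOne]
    exact fun ξ => ⟨contr (K + 2) ξ v, symbolMap_contr φ h₁ h₂ ξ v⟩

/-- Iterated form of `prolongOne_range_symbolMap`. -/
theorem prolong_range_symbolMap (φ : SymT n q F →ₗ[ℝ] G) {k M k₁ M₁ : ℕ} (h₀ : k = q + M)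
    (hac : IsAcyclic 2 (LinearMap.ker (symbolMap φ h₀))) (h₁ : k₁ = q + M₁) (hM : M₁ = M + 1)
    (t : ℕ) (h₂ : k₁ + t = q + (M₁ + t)) :
    prolong (LinearMap.range (symbolMap φ h₁)) t = LinearMap.range (symbolMap φ h₂) := by
  induction t with
  | zero => rfl
  | succ t ih =>
    rw [prolong, ih (by omega)]
    have hex := hac 1 one_lt_two t
    rw [cocycles, coboundaries, prolong_ker_symbolMap φ h₀ t (r' := M + t) (by omega),
      prolong_ker_symbolMap φ h₀ (t + 1) (r' := M + t + 1) (by omega)] at hex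
    -- freeing the degrees allows substitution, which avoids transport along equalities of degrees
    have key : ∀ k' M' (e : k' = k + t + 1) (e' : M' = M + t + 1),
        prolongOne (LinearMap.range (symbolMap φ (k := k') (r := M') (by omega))) =
        LinearMap.range (symbolMap φ (k := k' + 1) (r := M' + 1) (by omega)) := by
      rintro _ _ rfl rfl
      exact prolongOne_range_symbolMap φ _ _ _ hex
    exact key (k₁ + t) (M₁ + t) (by omega) (by omega)

/-- If the kernel is `(p + 1)`-acyclic from some degree on, then the image is `p`-acyclic from the next
degree on. -/
theorem isAcyclic_range_symbolMap (φ : SymT n q F →ₗ[ℝ] G) {k M k₁ M₁ p : ℕ} (h₀ : k = q + M)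
    (hp : 1 ≤ p) (hac : IsAcyclic (p + 1) (LinearMap.ker (symbolMap φ h₀)))
    (h₁ : k₁ = q + M₁) (hM : M₁ = M + 1) :
    IsAcyclic p (LinearMap.range (symbolMap φ h₁)) := by
  intro j hj r
  have hac₂ : IsAcyclic 2 (LinearMap.ker (symbolMap φ h₀)) :=
    fun i hi => hac i (hi.trans_le (Nat.succ_le_succ hp))
  have hex := hac (j + 1) (by omega) r
  rw [cocycles, coboundaries, prolong_ker_symbolMap φ h₀ r (r' := M + r) (by omega),
    prolong_ker_symbolMap φ h₀ (r + 1) (r' := M + r + 1) (by omega)] at hex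
  rw [cocycles, coboundaries, prolong_range_symbolMap φ h₀ hac₂ h₁ hM r (by omega),
    prolong_range_symbolMap φ h₀ hac₂ h₁ hM (r + 1) (by omega)]
  -- as above, the degrees are freed to be substituted
  have key : ∀ k' M' (e : k' = k + r + 1) (e' : M' = M + r + 1),
      formsIn (j + 1) (LinearMap.range (symbolMap φ (k := k') (r := M') (by omega))) ⊓
        LinearMap.ker (spencerDelta (n := n) (W := G) (j + 1) M') ≤
      (formsIn j (LinearMap.range (symbolMap φ (k := k' + 1) (r := M' + 1) (by omega)))).map
        (spencerDelta (n := n) (W := G) j (M' + 1)) := by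
    rintro _ _ rfl rfl β ⟨hβ, hδ⟩
    exact mem_map_spencerDelta_range φ _ _ _ hex hβ hδ
  exact key (k₁ + r) (M₁ + r) (by omega) (by omega)

end SymbolMaps

/-! ### Iterated partial derivatives and polynomials with prescribed derivatives -/

section LocalCalculus

variable {n : ℕ} {V W : Type*} [NormedAddCommGroup V] [NormedSpace ℝ V]
  [NormedAddCommGroup W] [NormedSpace ℝ W]

theorem pderivList_append (l l' : List (Fin n)) (u : TSp n → W) :
    pderivList (l ++ l') u = pderivList l (pderivList l' u) := List.foldr_append

theorem SmoothNear.add {u w : TSp n → W} {z : TSp n} (hu : SmoothNear u z) (hw : SmoothNear w z) :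
    SmoothNear (u + w) z := by
  filter_upwards [hu, hw] with y h1 h2 using h1.add h2

theorem SmoothNear.sum {ι : Type*} (t : Finset ι) {u : ι → TSp n → W} {z : TSp n}
    (hu : ∀ i ∈ t, SmoothNear (u i) z) : SmoothNear (fun y => ∑ i ∈ t, u i y) z := by
  filter_upwards [t.eventually_all.2 hu] with y hy using ContDiffAt.sum hy

theorem SmoothNear.clm_apply {A : TSp n → V →L[ℝ] W} {u : TSp n → V} {z : TSp n}
    (hA : SmoothNear A z) (hu : SmoothNear u z) : SmoothNear (fun y => A y (u y)) z := by
  filter_upwards [hA, hu] with y h1 h2 using h1.clm_apply h2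

theorem pderiv_comm {u : TSp n → W} {z : TSp n} (hu : SmoothNear u z) (i j : Fin n) :
    pderiv i (pderiv j u) =ᶠ[𝓝 z] pderiv j (pderiv i u) := by
  filter_upwards [hu] with y hy
  have h2 : DifferentiableAt ℝ (fderiv ℝ u) y :=
    (hy.fderiv_right (m := ∞) (by simp)).differentiableAt (by simp)
  have key : ∀ a b : Fin n, pderiv a (pderiv b u) y =
      fderiv ℝ (fderiv ℝ u) y (EuclideanSpace.single a 1) (EuclideanSpace.single b 1) := by
    intro a b
    change fderiv ℝ (fun y => fderiv ℝ u y (EuclideanSpace.single b 1)) y _ = _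
    rw [fderiv_clm_apply h2 (differentiableAt_const _)]
    simp
  rw [key, key]
  have h2le : (2 : ℕ∞ω) ≤ ∞ := WithTop.coe_le_coe.2 (le_top (a := (2 : ℕ∞)))
  exact (hy.isSymmSndFDerivAt (by simpa using h2le)).eq _ _

theorem pderivList_perm {l l' : List (Fin n)} (h : l.Perm l') {u : TSp n → W} {z : TSp n}
    (hu : SmoothNear u z) : pderivList l u =ᶠ[𝓝 z] pderivList l' u := by
  induction h with
  | nil => rfl
  | cons i _ ih => exact pderivList_congr ih [i]
  | swap i j l => exact pderiv_comm (hu.pderivList l) j i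
  | trans _ _ ih ih' => exact ih.trans ih'

/-- The list of directions `1, …, 1, 2, …, 2, …` along which `∂_μ` differentiates. -/
def multiList (μ : Fin n → ℕ) : List (Fin n) :=
  (List.finRange n).flatMap fun i => List.replicate (μ i) i

theorem mderiv_eq (μ : Fin n → ℕ) (u : TSp n → W) : mderiv μ u = pderivList (multiList μ) u := rfl

theorem count_multiList (μ : Fin n → ℕ) (i : Fin n) : (multiList μ).count i = μ i := by
  rw [multiList, List.count_flatMap]
  have : (List.map (List.count i ∘ fun j => List.replicate (μ j) j) (List.finRange n)) =
      List.map (fun j => if j = i then μ j else 0) (List.finRange n) := by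
    refine List.map_congr_left fun j _ => ?_
    simp [List.count_replicate]
  rw [this, ← List.ofFn_eq_map, List.sum_ofFn]
  simp

theorem length_eq_sum_count (l : List (Fin n)) : l.length = ∑ i, l.count i := by
  induction l with
  | nil => simp
  | cons j l ih => simp [List.count_cons, Finset.sum_add_distrib, ih]

theorem length_multiList (μ : Fin n → ℕ) : (multiList μ).length = ∑ i, μ i := by
  rw [length_eq_sum_count]
  simp only [count_multiList]

theorem pderivList_eq_mderiv (l : List (Fin n)) {u : TSp n → W} {z : TSp n} (hu : SmoothNear u z) :
    pderivList l u =ᶠ[𝓝 z] mderiv (fun i => l.count i) u :=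
  pderivList_perm (List.perm_iff_count.2 fun i => (count_multiList (fun i => l.count i) i).symm) hu

theorem mderiv_mderiv (μ ν : Fin n → ℕ) {u : TSp n → W} {z : TSp n} (hu : SmoothNear u z) :
    mderiv ν (mderiv μ u) =ᶠ[𝓝 z] mderiv (μ + ν) u := by
  rw [mderiv_eq, mderiv_eq, ← pderivList_append]
  refine pderivList_perm (List.perm_iff_count.2 fun i => ?_) hu
  rw [List.count_append, count_multiList, count_multiList]
  exact (add_comm _ _).trans (count_multiList (μ + ν) i).symm

theorem pderivList_sum {ι : Type*} (t : Finset ι) {u : ι → TSp n → W} {z : TSp n}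
    (hu : ∀ i ∈ t, SmoothNear (u i) z) (l : List (Fin n)) :
    pderivList l (fun y => ∑ i ∈ t, u i y) z = ∑ i ∈ t, pderivList l (u i) z := by
  classical
  induction t using Finset.induction_on with
  | empty =>
    have h0 : pderivList l (fun _ : TSp n => (0 : W)) = fun _ => 0 := by
      induction l with
      | nil => rfl
      | cons i l ih =>
        change pderiv i (pderivList l fun _ => 0) = _
        rw [ih]
        funext y
        simp [pderiv]
    simp [h0]
  | insert a t ha ih =>
    have h1 : (fun y => ∑ i ∈ insert a t, u i y) = u a + fun y => ∑ i ∈ t, u i y := by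
      funext y
      simp [Finset.sum_insert ha]
    rw [h1, (pderivList_add (hu a (by simp))
      (SmoothNear.sum t fun i hi => hu i (by simp [hi])) l).self_of_nhds, Finset.sum_insert ha,
      Pi.add_apply, ih fun i hi => hu i (by simp [hi])]

/-- If all derivatives of `u` along lists shorter than `l` vanish at `z`, only the term of the Leibniz
formula with all derivatives on `u` survives in `∂_l (A u)(z)`. -/
theorem pderivList_clm_apply_of_vanishing (l : List (Fin n)) {A : TSp n → V →L[ℝ] W}
    {u : TSp n → V} {z : TSp n} (hA : SmoothNear A z) (hu : SmoothNear u z)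
    (h : ∀ l' : List (Fin n), l'.length < l.length → pderivList l' u z = 0) :
    pderivList l (fun y => A y (u y)) z = A z (pderivList l u z) := by
  induction l using List.reverseRecOn generalizing A u with
  | nil => rfl
  | append_singleton l i ih =>
    have hl : (l ++ [i]).length = l.length + 1 := by simp
    have hd : pderivList [i] (fun y => A y (u y)) =ᶠ[𝓝 z]
        (fun y => pderiv i A y (u y)) + fun y => A y (pderiv i u y) := by
      filter_upwards [hA, hu] with y h1 h2
      change fderiv ℝ (fun y => A y (u y)) y _ = _
      rw [fderiv_clm_apply (h1.differentiableAt (by simp)) (h2.differentiableAt (by simp)),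
        add_comm]
      rfl
    rw [pderivList_append, (pderivList_congr hd l).self_of_nhds,
      (pderivList_add ((hA.pderiv i).clm_apply hu) (hA.clm_apply (hu.pderiv i)) l).self_of_nhds,
      Pi.add_apply, ih (hA.pderiv i) hu fun l' hl' => h l' (by omega),
      ih hA (hu.pderiv i) fun l' hl' => ?_, h l (by omega), map_zero, zero_add, pderivList_append]
    · rfl
    · have := h (l' ++ [i]) (by simp; omega)
      rwa [pderivList_append] at this

/-- The homogeneous polynomial of degree `k` centred at `z₀` whose `k`-th derivatives are the
components of `v`, given recursively by Euler's identity. -/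
noncomputable def taylorPoly (z₀ : TSp n) : (k : ℕ) → SymT n k W → TSp n → W
  | 0, v, _ => v ⟨0, by simp⟩
  | k + 1, v, z => ((k + 1 : ℕ) : ℝ)⁻¹ •
      ∑ i, (z i - z₀ i) • taylorPoly z₀ k (contr (k + 1) (EuclideanSpace.single i 1) v) z

theorem contDiff_taylorPoly (z₀ : TSp n) (k : ℕ) (v : SymT n k W) :
    ContDiff ℝ ∞ (taylorPoly z₀ k v) := by
  induction k with
  | zero => exact contDiff_const
  | succ k ih =>
    refine ContDiff.const_smul _ (ContDiff.sum fun i _ => ContDiff.smul ?_ (ih _))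
    exact (contDiff_piLp_apply (𝕜 := ℝ) 2 (i := i)).sub contDiff_const

theorem pderiv_taylorPoly_zero (z₀ : TSp n) (v : SymT n 0 W) (i : Fin n) :
    pderiv i (taylorPoly z₀ 0 v) = 0 := by
  funext z
  change fderiv ℝ (fun _ => v ⟨0, _⟩) z _ = 0
  simp

theorem pderiv_taylorPoly_succ (z₀ : TSp n) (k : ℕ) (v : SymT n (k + 1) W) (j : Fin n) :
    pderiv j (taylorPoly z₀ (k + 1) v) =
      taylorPoly z₀ k (contr (k + 1) (EuclideanSpace.single j 1) v) := by
  have step : ∀ (k : ℕ) (v : SymT n (k + 1) W) (z : TSp n),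
      pderiv j (taylorPoly z₀ (k + 1) v) z = ((k + 1 : ℕ) : ℝ)⁻¹ •
        (taylorPoly z₀ k (contr (k + 1) (EuclideanSpace.single j 1) v) z +
          ∑ i, (z i - z₀ i) •
            pderiv j (taylorPoly z₀ k (contr (k + 1) (EuclideanSpace.single i 1) v)) z) := by
    intro k v z
    have hT : ∀ i, HasFDerivAt (taylorPoly z₀ k (contr (k + 1) (EuclideanSpace.single i 1) v))
        (fderiv ℝ (taylorPoly z₀ k (contr (k + 1) (EuclideanSpace.single i 1) v)) z) z :=
      fun i => ((contDiff_taylorPoly z₀ k _).differentiable (by simp) z).hasFDerivAt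
    have hc : ∀ i, HasFDerivAt (fun y : TSp n => y i - z₀ i) (EuclideanSpace.proj (𝕜 := ℝ) i) z :=
      fun i => (EuclideanSpace.proj (𝕜 := ℝ) i).hasFDerivAt.sub_const _
    have hS := (HasFDerivAt.fun_sum (u := Finset.univ) fun i _ => (hc i).smul (hT i)).const_smul
      ((k + 1 : ℕ) : ℝ)⁻¹
    have hS' : fderiv ℝ (taylorPoly z₀ (k + 1) v) z = _ := hS.fderiv
    change fderiv ℝ (taylorPoly z₀ (k + 1) v) z (EuclideanSpace.single j 1) = _
    rw [hS', smul_apply, sum_apply]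
    congr 1
    simp only [add_apply, Finset.sum_add_distrib]
    rw [add_comm]
    congr 1
    rw [Finset.sum_eq_single j]
    · simp
    · intro i _ hi
      simp [hi]
    · simp
  induction k with
  | zero =>
    funext z
    rw [step]
    simp only [pderiv_taylorPoly_zero]
    simp
  | succ k ih =>
    funext z
    rw [step]
    have hcomm : ∀ i, pderiv j (taylorPoly z₀ (k + 1)
        (contr (k + 2) (EuclideanSpace.single i 1) v)) z =
        taylorPoly z₀ k (contr (k + 1) (EuclideanSpace.single i 1)
          (contr (k + 2) (EuclideanSpace.single j 1) v)) z := by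
      intro i
      refine (congrFun (ih _) z).trans ?_
      exact congrArg (fun w => taylorPoly z₀ k w z) (contr_comm (k + 1) _ _ v)
    have hsum : ∑ i, (z i - z₀ i) • pderiv j (taylorPoly z₀ (k + 1)
        (contr (k + 2) (EuclideanSpace.single i 1) v)) z = ((k + 1 : ℕ) : ℝ) •
        taylorPoly z₀ (k + 1) (contr (k + 2) (EuclideanSpace.single j 1) v) z := by
      simp only [hcomm]
      rw [taylorPoly, smul_smul, mul_inv_cancel₀ (by positivity), one_smul]
    refine (congrArg (fun w => ((k + 1 + 1 : ℕ) : ℝ)⁻¹ • (_ + w)) hsum).trans ?_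
    have hsucc : ∀ w : W, w + ((k + 1 : ℕ) : ℝ) • w = ((k + 1 + 1 : ℕ) : ℝ) • w := fun w => by
      rw [Nat.cast_succ (k + 1), add_smul, one_smul, add_comm]
    exact (congrArg _ (hsucc _)).trans (inv_smul_smul₀ (by positivity) _)

theorem pderivList_taylorPoly_of_lt (z₀ : TSp n) (l : List (Fin n)) {k : ℕ} (v : SymT n k W)
    (hl : l.length < k) : pderivList l (taylorPoly z₀ k v) z₀ = 0 := by
  induction l using List.reverseRecOn generalizing k with
  | nil =>
    obtain ⟨k, rfl⟩ : ∃ k', k = k' + 1 := ⟨k - 1, by simp at hl; omega⟩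
    simp [pderivList, taylorPoly]
  | append_singleton l i ih =>
    rw [List.length_append, List.length_singleton] at hl
    obtain ⟨k, rfl⟩ : ∃ k', k = k' + 1 := ⟨k - 1, by omega⟩
    rw [pderivList_append]
    change pderivList l (pderiv i (taylorPoly z₀ (k + 1) v)) z₀ = 0
    rw [pderiv_taylorPoly_succ]
    exact ih (k := k) _ (by omega)

theorem pderivList_taylorPoly (z₀ : TSp n) (l : List (Fin n)) {k : ℕ} (v : SymT n k W)
    (μ : MIdx n k) (hμ : ∀ i, μ.1 i = l.count i) : pderivList l (taylorPoly z₀ k v) z₀ = v μ := by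
  induction l using List.reverseRecOn generalizing k with
  | nil =>
    have h0 : μ.1 = 0 := funext hμ
    obtain rfl : k = 0 := by rw [← μ.2, h0]; simp
    exact congrArg v (Subtype.ext h0.symm)
  | append_singleton l i ih =>
    have hk : k = l.length + 1 := by
      rw [← μ.2, Finset.sum_congr rfl fun i _ => hμ i, ← length_eq_sum_count]
      simp
    subst hk
    rw [pderivList_append]
    change pderivList l (pderiv i (taylorPoly z₀ (l.length + 1) v)) z₀ = _
    rw [pderiv_taylorPoly_succ]
    let ν : MIdx n l.length := ⟨fun i => l.count i, (length_eq_sum_count l).symm⟩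
    refine (ih (k := l.length) _ ν fun _ => rfl).trans ?_
    rw [contr_single]
    refine congrArg v (Subtype.ext (funext fun m => ?_))
    rw [hμ, List.count_append]
    change l.count m + (Pi.single i 1 : Fin n → ℕ) m = _
    by_cases hm : m = i
    · subst hm; simp
    · simp [hm, Ne.symm hm]

end LocalCalculus

/-! ### Jets of sections and the symbol of the compatibility conditions -/

section JetsOfSections

variable {n : ℕ} {X : Type*} [TopologicalSpace X] [ChartedSpace (TSp n) X]
  [IsManifold 𝓘(ℝ, TSp n) ∞ X]
  {F : Type*} [NormedAddCommGroup F] [NormedSpace ℝ F]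
  {E : X → Type*} [TopologicalSpace (TotalSpace F E)]
  [∀ x, AddCommGroup (E x)] [∀ x, Module ℝ (E x)] [∀ x, TopologicalSpace (E x)]
  [FiberBundle F E] [VectorBundle ℝ F E] [ContMDiffVectorBundle ∞ F E 𝓘(ℝ, TSp n)]
  {G : Type*} [NormedAddCommGroup G] [NormedSpace ℝ G]
  {F₀ : X → Type*} [TopologicalSpace (TotalSpace G F₀)]
  [∀ x, AddCommGroup (F₀ x)] [∀ x, Module ℝ (F₀ x)] [∀ x, TopologicalSpace (F₀ x)]
  [FiberBundle G F₀] [VectorBundle ℝ G F₀] [ContMDiffVectorBundle ∞ G F₀ 𝓘(ℝ, TSp n)]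

theorem jetTop_injective (k : ℕ) : Function.Injective (jetTop n k F) := by
  intro v w h
  funext μ
  have := congrFun h ⟨μ.1, μ.2.le⟩
  simpa [jetTop, μ.2] using this

variable (E) in
/-- Every symmetric tensor of degree `k` is the `k`-jet of a local section. -/
theorem exists_jetAt_eq_jetTop (k : ℕ) (x : X) (v : SymT n k F) :
    ∃ f ∈ LocSec n F E x, jetAt k x f = jetTop n k F v := by
  set z₀ := chartAt (TSp n) x x
  let f : ∀ y, E y := fun y =>
    (trivializationAt F E x).symm y (taylorPoly z₀ k v (chartAt (TSp n) x y))
  have hf : locRep F x f =ᶠ[𝓝 z₀] taylorPoly z₀ k v := by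
    filter_upwards [eventually_baseSet_symm (F := F) (E := E) x,
      (chartAt (TSp n) x).open_target.mem_nhds (mem_chart_target _ x)] with z hz hz'
    simp only [locRep, f]
    rw [(trivializationAt F E x).apply_mk_symm hz, (chartAt (TSp n) x).right_inv hz']
  have hs : SmoothNear (locRep F x f) z₀ := by
    filter_upwards [eventually_eventually_nhds.2 hf] with y hy
    exact (contDiff_taylorPoly z₀ k v).contDiffAt.congr_of_eventuallyEq hy
  refine ⟨f, mem_locSec_iff.2 hs, ?_⟩
  funext μ
  change pderivList (multiList μ.1) (locRep F x f) z₀ = _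
  rw [(pderivList_congr hf _).self_of_nhds]
  by_cases h : ∑ i, μ.1 i = k
  · rw [pderivList_taylorPoly z₀ _ v ⟨μ.1, h⟩ fun i => (count_multiList _ i).symm]
    simp [jetTop, h]
  · rw [pderivList_taylorPoly_of_lt z₀ _ v (by rw [length_multiList]; exact μ.2.lt_of_ne h)]
    simp [jetTop, h]

/-- The components of top order of a jet. -/
def Jet.top {k : ℕ} (y : Jet n k F) : SymT n k F := fun μ => y ⟨μ.1, μ.2.le⟩

theorem Jet.top_jetTop {k : ℕ} (v : SymT n k F) : (jetTop n k F v).top = v := by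
  funext μ
  simp [Jet.top, jetTop, μ.2]

namespace PDESystem

variable {q : ℕ} (S : PDESystem n F E G F₀ q)

theorem g_eq_ker (x : X) : S.g x = LinearMap.ker (S.σ₀ x) := by
  have hx := FiberBundle.mem_baseSet_trivializationAt' (F := G) (E := F₀) x
  ext v
  change S.Φ x (jetTop n q F v) = 0 ↔
    (trivializationAt G F₀ x).linearMapAt ℝ x (S.Φ x (jetTop n q F v)) = 0
  refine ⟨fun h => by rw [h, map_zero], fun h => ?_⟩
  rw [← (trivializationAt G F₀ x).symmₗ_linearMapAt (R := ℝ) hx (S.Φ x (jetTop n q F v)), h,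
    map_zero]

theorem h_eq_range (r : ℕ) (x : X) {k : ℕ} (hk : k = q + r) :
    S.h r x = LinearMap.range (symbolMap (S.σ₀ x) hk) := by
  subst hk
  rfl

/-- The coefficients of a local expression of the operator compute its symbol. -/
theorem σ₀_apply_eq_sum {x : X} {U : Set (TSp n)} (hU : U ∈ 𝓝 (chartAt (TSp n) x x))
    {a : MIdxLE n q → TSp n → (F →L[ℝ] G)}
    (ha : ∀ z ∈ U, ∀ f ∈ LocSec n F E ((chartAt (TSp n) x).symm z),
      locRep G x (fun y => S.Φ y (jetAt q y f)) z = ∑ μ, a μ z (mderiv μ.1 (locRep F x f) z))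
    (v : SymT n q F) :
    S.σ₀ x v = ∑ μ, a μ (chartAt (TSp n) x x) (jetTop n q F v μ) := by
  obtain ⟨f, hf, hfv⟩ := exists_jetAt_eq_jetTop E q x v
  have h := ha _ (mem_of_mem_nhds hU) f (by
    rwa [(chartAt (TSp n) x).left_inv (mem_chart_source _ x)])
  rw [locRep_apply_chart (mem_chart_source _ x)] at h
  have hx := FiberBundle.mem_baseSet_trivializationAt' (F := G) (E := F₀) x
  rw [← hfv]
  refine Eq.trans ?_ h
  change (trivializationAt G F₀ x).linearMapAt ℝ x (S.Φ x (jetTop n q F v)) = _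
  rw [Trivialization.coe_linearMapAt_of_mem _ hx, hfv]

/-- If the derivatives of `f` of order less than `q + r` vanish at `x`, then `j_r(𝒟 f)(x)` depends only
on the derivatives of order `q + r`, through the symbol map. -/
theorem jetAt_op_of_vanishing (r : ℕ) {x : X} {f : ∀ y, E y} (hf : f ∈ LocSec n F E x)
    (h0 : ∀ μ : MIdxLE n (q + r), ∑ i, μ.1 i < q + r →
      (jetAt (q + r) x f : Jet n (q + r) F) μ = 0) :
    (jetAt r x (S.op f) : Jet n r G) =
      jetTop n r G (S.σ r x (Jet.top (jetAt (q + r) x f))) := by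
  obtain ⟨U, hU, a, ha_smooth, ha⟩ := S.smooth x
  set z₀ := chartAt (TSp n) x x
  set u := locRep (n := n) F x f
  have hu : SmoothNear u z₀ := mem_locSec_iff.1 hf
  have hc := (chartAt (TSp n) x).symm.continuousAt (x := chartAt (TSp n) x x)
    (mem_chart_target _ x)
  rw [ContinuousAt, (chartAt (TSp n) x).left_inv (mem_chart_source _ x)] at hc
  have heq : locRep G x (S.op f) =ᶠ[𝓝 z₀] fun z => ∑ μ, a μ z (mderiv μ.1 u z) := by
    filter_upwards [hU, hc.eventually (eventually_eventually_nhds.2 hf)] with z h1 h2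
    exact ha z h1 f h2
  have hA : ∀ μ, SmoothNear (a μ) z₀ := fun μ => by
    filter_upwards [hU] with z hz using ha_smooth μ z hz
  have hvan : ∀ l : List (Fin n), l.length < q + r → pderivList l u z₀ = 0 := by
    intro l hl
    rw [(pderivList_eq_mderiv l hu).self_of_nhds]
    rw [length_eq_sum_count] at hl
    exact h0 ⟨fun i => l.count i, hl.le⟩ hl
  funext ν
  -- a list shorter than `ν`, followed by `μ`, has length less than `q + r`
  have hterm : ∀ μ : MIdxLE n q, pderivList (multiList ν.1) (fun z => a μ z (mderiv μ.1 u z)) z₀ =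
      a μ z₀ (mderiv (μ.1 + ν.1) u z₀) := by
    intro μ
    rw [pderivList_clm_apply_of_vanishing _ (hA μ) (hu.mderiv μ.1), ← mderiv_eq,
      (mderiv_mderiv μ.1 ν.1 hu).self_of_nhds]
    intro l hl
    rw [mderiv_eq, ← pderivList_append]
    refine hvan _ ?_
    have hμ := μ.2
    have hν := ν.2
    rw [length_multiList] at hl
    rw [List.length_append, length_multiList]
    omega
  have hL : (jetAt r x (S.op f) : Jet n r G) ν = ∑ μ, a μ z₀ (mderiv (μ.1 + ν.1) u z₀) := by
    change pderivList (multiList ν.1) (locRep G x (S.op f)) z₀ = _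
    rw [(pderivList_congr heq _).self_of_nhds,
      pderivList_sum _ fun μ _ => (hA μ).clm_apply (hu.mderiv μ.1)]
    exact Finset.sum_congr rfl fun μ _ => hterm μ
  have hsmall : ∀ μ : MIdxLE n q, ∑ i, μ.1 i + ∑ i, ν.1 i ≠ q + r →
      mderiv (μ.1 + ν.1) u z₀ = 0 := by
    intro μ hne
    rw [mderiv_eq]
    refine hvan _ ?_
    have hμ := μ.2
    have hν := ν.2
    rw [length_multiList]
    simp only [Pi.add_apply, Finset.sum_add_distrib]
    omega
  rw [hL]
  by_cases hν : ∑ i, ν.1 i = r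
  · have hR : jetTop n r G (S.σ r x (Jet.top (jetAt (q + r) x f))) ν =
        S.σ₀ x fun μ => Jet.top (jetAt (q + r) x f) (μ.add ⟨ν.1, hν⟩) := dif_pos hν
    rw [hR, S.σ₀_apply_eq_sum hU ha]
    refine Finset.sum_congr rfl fun μ _ => congrArg _ ?_
    by_cases hμ : ∑ i, μ.1 i = q
    · exact Eq.symm (dif_pos hμ)
    · rw [hsmall μ (by omega)]
      exact Eq.symm (dif_neg hμ)
  · have hR : jetTop n r G (S.σ r x (Jet.top (jetAt (q + r) x f))) ν = 0 := dif_neg hν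
    rw [hR]
    refine Finset.sum_eq_zero fun μ _ => ?_
    have hμ := μ.2
    have hν' := ν.2
    rw [hsmall μ (by omega), map_zero]

/-- Formal integrability enters here: a compatibility jet of order `r + 1` without lower order terms
comes from some `f` with `j_{q+r}(f)(x) ∈ R_{q+r}`. Subtracting a lift of it to `R_{q+r+1}` leaves only
derivatives of order `q + r + 1`, and these contribute through the symbol map. -/
theorem ccSymbol_eq_h (hS : S.FormallyIntegrable) (r : ℕ) (x : X) :
    S.ccSymbol (r + 1) x = S.h (r + 1) x := by
  ext w
  constructor
  · rintro ⟨f, hf⟩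
    have hf' : jetAt (r + 1) x (S.op f.1) = jetTop n (r + 1) G w := hf
    have hr : S.jetOp r x f = 0 := by
      funext μ
      have h := congrFun hf' ⟨μ.1, μ.2.trans (Nat.le_succ r)⟩
      exact h.trans (dif_neg (Nat.lt_succ_of_le μ.2).ne)
    have hR : jetL n F E (q + r) x f ∈ S.R r x := ⟨f, hr, rfl⟩
    rw [← (hS r).2 x] at hR
    obtain ⟨_, ⟨f', hf'0, rfl⟩, hproj⟩ := hR
    have hu : S.jetOp (r + 1) x (f - f') = jetTop n (r + 1) G w := by
      rw [map_sub, show S.jetOp (r + 1) x f' = 0 from hf'0, sub_zero]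
      exact hf
    have hlow : ∀ μ : MIdxLE n (q + (r + 1)), ∑ i, μ.1 i < q + (r + 1) →
        jetL n F E (q + (r + 1)) x (f - f') μ = 0 := by
      intro μ hμ
      have h := congrFun hproj ⟨μ.1, Nat.le_of_lt_succ hμ⟩
      rw [map_sub]
      exact sub_eq_zero.2 h.symm
    have key := S.jetAt_op_of_vanishing (r + 1) (f - f').2 hlow
    exact ⟨_, jetTop_injective _ (key.symm.trans hu)⟩
  · rintro ⟨v, rfl⟩
    obtain ⟨f, hf, hfv⟩ := exists_jetAt_eq_jetTop E (q + (r + 1)) x v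
    refine ⟨⟨f, hf⟩, ?_⟩
    have key := S.jetAt_op_of_vanishing (r + 1) hf fun μ hμ => by
      rw [hfv]
      exact dif_neg hμ.ne
    rw [hfv, Jet.top_jetTop] at key
    exact key

end PDESystem

end JetsOfSections

theorem corollary3p11 {n : ℕ}
    {X : Type*} [TopologicalSpace X] [ChartedSpace (TSp n) X] [IsManifold 𝓘(ℝ, TSp n) ∞ X]
    {F : Type*} [NormedAddCommGroup F] [NormedSpace ℝ F] [FiniteDimensional ℝ F]
    {E : X → Type*} [TopologicalSpace (TotalSpace F E)]
    [∀ x, AddCommGroup (E x)] [∀ x, Module ℝ (E x)] [∀ x, TopologicalSpace (E x)]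
    [FiberBundle F E] [VectorBundle ℝ F E] [ContMDiffVectorBundle ∞ F E 𝓘(ℝ, TSp n)]
    {G : Type*} [NormedAddCommGroup G] [NormedSpace ℝ G] [FiniteDimensional ℝ G]
    {F₀ : X → Type*} [TopologicalSpace (TotalSpace G F₀)]
    [∀ x, AddCommGroup (F₀ x)] [∀ x, Module ℝ (F₀ x)] [∀ x, TopologicalSpace (F₀ x)]
    [FiberBundle G F₀] [VectorBundle ℝ G F₀] [ContMDiffVectorBundle ∞ G F₀ 𝓘(ℝ, TSp n)]
    {q : ℕ} (S : PDESystem n F E G F₀ q) (hS : S.FormallyIntegrable)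
    (s : ℕ) (hs : ∀ x, IsAcyclic 2 (prolong (S.g x) s))
    (s' : ℕ) (hs' : ∀ x, IsAcyclic 3 (prolong (S.g x) (s + s'))) :
    ∀ x, prolong (S.ccSymbol (s + 1) x) s' = S.h (s + 1 + s') x ∧
      IsAcyclic 2 (S.h (s + 1 + s') x) := by
  intro x
  have h₂ := hs x
  have h₃ := hs' x
  rw [S.g_eq_ker x, prolong_ker (S.σ₀ x) _ rfl] at h₂ h₃
  constructor
  · rw [S.ccSymbol_eq_h hS, S.h_eq_range (s + 1) x rfl,
      S.h_eq_range (s + 1 + s') x (k := q + (s + 1) + s') (add_assoc _ _ _)]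
    exact prolong_range_symbolMap (S.σ₀ x) rfl h₂ rfl rfl s' _
  · rw [S.h_eq_range (s + 1 + s') x rfl]
    exact isAcyclic_range_symbolMap (S.σ₀ x) rfl one_le_two h₃ rfl (by omega)
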